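/- Let $p<p'$ be positive coprime integers, and let $s_0,r_0$ be the smallest non-negative integers with $|ps_0-p'r_0|=1$ (that is, $(s_0,r_0)$ is the componentwise least such pair). **The polynomial $\chi$.** For integers $a,b,c$ with $c=b\pm1$ and $L\ge 0$, let $\mathcal P^{p,p'}_{a,b,c}(L)$ be the set of integer sequences $h=(h_0,\dots,h_L)$ with $1\le h_i\le p'-1$, $h_{i+1}=h_i\pm1$, $h_0=a$, $h_L=b$. Put $h_{L+1}=c$ and $$wt(h)=\sum_{i=1}^{L} i\,c_{FB}(h_{i-1},h_i,h_{i+1}),$$ where $c_{FB}(h-1,h,h+1)=c_{FB}(h+1,h,h-1)=\tfrac12$, $c_{FB}(h,h+1,h)=-\lfloor h(p'-p)/p'\rfloor$ and $c_{FB}(h,h-1,h)=\lfloor h(p'-p)/p'\rfloor$. With $\hat r(c)=\lfloor (p'-p)c/p'\rfloor$, define $$\chi^{p,p'}_{a,b,b\pm1}(L)=q^{-\hat r(c)(a-b\pm L)/2-(a-b)(a-c)/4}\sum_{h\in\mathcal P^{p,p'}_{a,b,c}(L)}q^{wt(h)},\qquad c=b\pm1 .$$ **Gaussian polynomials.** $\left[{A\atop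 B}\right]_q=\dfrac{\prod_{i=1}^{A}(1-q^i)}{\prod_{i=1}^{B}(1-q^i)\prod_{i=1}^{A-B}(1-q^i)}$ if $0\le B\le A$, and $0$ otherwise. **Continued fraction.** Let $(e_0,e_1,\dots,e_{n-1},e_n+2)=(c_0,\dots,c_n)$ be the continued fraction of $p'/p$, that is, $p'/p=c_0+1/(c_1+1/(\cdots+1/c_n))$ with integers $c_0\ge0$, $c_i\ge1$ for $0<i<n$, and $c_n\ge2$. **Theorem.** For every even $L\ge0$, $$\chi^{p,p'}_{s_0,s_0,s_0+1}(L)=\sum q^{\sum_{\mu=0}^n\sum_{i=1}^{e_\mu}(\lambda^{(\mu)}_i)^2}\prod_{\mu=0}^{n}\ \prod_{i=1+\delta_{\mu,0}}^{e_\mu}\left[{2\bigl(w_\mu-\sum_{j=1}^i\lambda^{(\mu)}_j\bigr)+\lambda^{(\mu)}_{i-1}+\lambda^{(\mu)}_i\atop \lambda^{(\mu)}_{i-1}-\lambda^{(\mu)}_i}\right]_q ,$$ where the sum is over all sequences $\lambda^{(0)},\dots,\lambda^{(n)}$ of partitions $\lambda^{(\mu)}=(\lambda^{(\mu)}_1\ge\lambda^{(\mu)}_2\ge\cdots\ge\lambda^{(\mu)}_{e_\mu}\ge0)$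 (with $\lambda^{(\mu)}_i=0$ for $i>e_\mu$) such that $\lambda^{(\mu)}_1\le\lambda^{(\mu)}_0$ for $0<\mu\le n$, $wt(\lambda^{(\mu)})\le w_\mu$ for $0\le\mu\le n$, and $wt(\lambda^{(n)})=w_n$. Here $wt(\lambda^{(\mu)})=\sum_{i=1}^{e_\mu}\lambda^{(\mu)}_i$, $w_0=L/2$, and for $1\le\mu\le n$, $w_\mu=\lambda^{(\mu-1)}_{e_{\mu-1}}$ and $\lambda^{(\mu)}_0=w_{\mu-1}-wt(\lambda^{(\mu-1)})$. -/

import Mathlib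

noncomputable section

namespace PathGen

/-! ### Fractional powers of `q` -/

/-- Finite `ℚ`-linear combinations of formal powers `q ^ x` with `x ∈ ℚ`. -/
abbrev QPoly : Type := AddMonoidAlgebra ℚ ℚ

/-- The formal power `q ^ x`. -/
def qpow (x : ℚ) : QPoly := AddMonoidAlgebra.single x 1

/-! ### Gaussian polynomials -/

/-- `∏_{i=1}^{n} (1 - q^i)`. -/
def qfac (n : ℕ) : Polynomial ℚ := ∏ i ∈ Finset.Icc 1 n, (1 - Polynomial.X ^ i)

theorem qfac_zero : qfac 0 = 1 := by simp [qfac]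

theorem qfac_succ (n : ℕ) : qfac (n + 1) = qfac n * (1 - Polynomial.X ^ (n + 1)) := by
  simp [qfac, Finset.prod_Icc_succ_top]

theorem qfac_ne_zero (n : ℕ) : qfac n ≠ 0 := by
  refine Finset.prod_ne_zero_iff.2 fun i hi h => ?_
  have hi1 : 1 ≤ i := (Finset.mem_Icc.1 hi).1
  have := congrArg (Polynomial.eval 0) h
  simp [show i ≠ 0 by omega] at this

/-- The quotient defining a Gaussian polynomial is exact. -/
theorem qfac_mul_dvd (a b : ℕ) : qfac a * qfac b ∣ qfac (a + b) := by
  induction a generalizing b with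
  | zero => simp [qfac_zero]
  | succ a iha =>
    induction b with
    | zero => simp [qfac_zero]
    | succ b ihb =>
      obtain ⟨u, hu⟩ := iha (b + 1)
      obtain ⟨v, hv⟩ := ihb
      refine ⟨v + Polynomial.X ^ (b + 1) * u, ?_⟩
      have h1 : qfac (a + 1 + (b + 1))
          = qfac (a + (b + 1)) * (1 - Polynomial.X ^ (a + 1 + (b + 1))) := by
        rw [show a + 1 + (b + 1) = (a + (b + 1)) + 1 by ring, qfac_succ]
      have hv' : qfac (a + (b + 1)) = qfac (a + 1) * qfac b * v := by
        rw [← hv]; congr 1; ring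
      have h2 : (1 - Polynomial.X ^ (a + 1 + (b + 1)) : Polynomial ℚ)
          = (1 - Polynomial.X ^ (b + 1))
            + Polynomial.X ^ (b + 1) * (1 - Polynomial.X ^ (a + 1)) := by ring
      rw [h1, h2, mul_add]
      nth_rewrite 1 [hv']
      rw [hu, qfac_succ a, qfac_succ b]
      ring

/-- The Gaussian polynomial as a polynomial in `q`: the quotient
`∏_{i=1}^{A} (1-q^i) / (∏_{i=1}^{B} (1-q^i) ∏_{i=1}^{A-B} (1-q^i))` for `0 ≤ B ≤ A`,
and `0` otherwise. -/
def gaussPoly (A B : ℤ) : Polynomial ℚ :=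
  if 0 ≤ B ∧ B ≤ A then qfac A.toNat / (qfac B.toNat * qfac (A - B).toNat) else 0

theorem gaussPoly_mul {A B : ℤ} (h0 : 0 ≤ B) (h1 : B ≤ A) :
    gaussPoly A B * (qfac B.toNat * qfac (A - B).toNat) = qfac A.toNat := by
  rw [gaussPoly, if_pos ⟨h0, h1⟩, mul_comm]
  refine EuclideanDomain.mul_div_cancel'
    (mul_ne_zero (qfac_ne_zero _) (qfac_ne_zero _)) ?_
  have := qfac_mul_dvd B.toNat (A - B).toNat
  rwa [show B.toNat + (A - B).toNat = A.toNat by omega] at this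

/-- The Gaussian polynomial as an element of `QPoly`. -/
def gauss (A B : ℤ) : QPoly := Polynomial.aeval (qpow 1) (gaussPoly A B)

/-! ### Paths, their weights and their generating functions -/

/-- The paths `h_0, …, h_L` from `a` to `b` with `1 ≤ h_i ≤ p' - 1` and steps `±1`. -/
def paths (p' : ℕ) (a b : ℤ) (L : ℕ) : Finset (Fin (L + 1) → ℤ) :=
  (Fintype.piFinset fun _ => Finset.Icc (1 : ℤ) ((p' : ℤ) - 1)).filter fun h =>
    h 0 = a ∧ h (Fin.last L) = b ∧
      ∀ i : Fin L, h i.succ = h i.castSucc + 1 ∨ h i.succ = h i.castSucc - 1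

/-- The heights `h_0, …, h_L` of a path followed by `h_{L+1} = c`. -/
def height (L : ℕ) (c : ℤ) (h : Fin (L + 1) → ℤ) (i : ℕ) : ℤ :=
  if hi : i < L + 1 then h ⟨i, hi⟩ else c

/-- `⌊h (p' - p) / p'⌋`. -/
def rhat (p p' : ℕ) (h : ℤ) : ℤ := ⌊((h : ℚ) * ((p' : ℚ) - p)) / p'⌋

/-- The local weight `c_FB(x, y, z)` of a vertex with successive heights `x, y, z`:
`1/2` at straight vertices, `-⌊x(p'-p)/p'⌋` at `(x, x+1, x)` and
`+⌊x(p'-p)/p'⌋` at `(x, x-1, x)`. -/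
def localWeight (p p' : ℕ) (x y z : ℤ) : ℚ :=
  if x = z then (if y = x + 1 then -(rhat p p' x : ℚ) else (rhat p p' x : ℚ)) else 1 / 2

/-- The Forrester-Baxter weight of a path, where `h_{L+1} = c`. -/
def pathWeight (p p' : ℕ) (L : ℕ) (c : ℤ) (h : Fin (L + 1) → ℤ) : ℚ :=
  ∑ i ∈ Finset.Icc 1 L,
    (i : ℚ) * localWeight p p' (height L c h (i - 1)) (height L c h i) (height L c h (i + 1))

/-- The Forrester-Baxter generating function `φ^{p,p'}_{a,b,c}(L)`. -/
def phi (p p' : ℕ) (a b c : ℤ) (L : ℕ) : QPoly :=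
  ∑ h ∈ paths p' a b L, qpow (pathWeight p p' L c h)

/-- The renormalised generating function `χ^{p,p'}_{a,b,c}(L)`, for `c = b ± 1`
(so that `c - b` is the sign `±`). -/
def chi (p p' : ℕ) (a b c : ℤ) (L : ℕ) : QPoly :=
  qpow (-((rhat p p' c : ℚ) * ((a : ℚ) - b + (c - b) * L)) / 2
      - ((a : ℚ) - b) * ((a : ℚ) - c) / 4) * phi p p' a b c L

/-! ### Continued fractions -/

/-- The value `c_0 + 1/(c_1 + 1/(⋯ + 1/c_n))`. -/
def cfVal : ℕ → (ℕ → ℕ) → ℚ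
  | 0, c => c 0
  | n + 1, c => c 0 + 1 / cfVal n fun i => c (i + 1)

/-- `(c_0, …, c_n)` is the continued fraction of `x`: here `c_0 ≥ 0`, `c_i ≥ 1` for
`0 < i < n`, and `c_n ≥ 2`. -/
structure IsContinuedFraction (n : ℕ) (c : ℕ → ℕ) (x : ℚ) : Prop where
  one_le : ∀ i, 0 < i → i < n → 1 ≤ c i
  two_le : 2 ≤ c n
  eq_val : x = cfVal n c

/-! ### The sequences of partitions

A sequence of partitions is given by its parts `lam μ i`, which are `λ^{(μ)}_i` for
`0 ≤ μ ≤ n` and `1 ≤ i ≤ e_μ`, and are `0` for all other indices. -/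

/-- `wt(λ^{(μ)})`, the sum of the parts. -/
def wt (e : ℕ → ℕ) (lam : ℕ → ℕ → ℕ) (μ : ℕ) : ℕ := ∑ i ∈ Finset.Icc 1 (e μ), lam μ i

/-- `w_0 = L/2` (used for even `L`) and `w_μ = λ^{(μ-1)}_{e_{μ-1}}` for `μ ≥ 1`. -/
def w (e : ℕ → ℕ) (L : ℕ) (lam : ℕ → ℕ → ℕ) : ℕ → ℕ
  | 0 => L / 2
  | μ + 1 => lam μ (e μ)

/-- The numbers `λ^{(μ)}_i` including `i = 0`, where
`λ^{(μ)}_0 = w_{μ-1} - wt(λ^{(μ-1)})` for `μ ≥ 1` (the value at `μ = i = 0` is never used). -/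
def part (e : ℕ → ℕ) (L : ℕ) (lam : ℕ → ℕ → ℕ) : ℕ → ℕ → ℤ
  | 0, 0 => 0
  | μ + 1, 0 => (w e L lam μ : ℤ) - wt e lam μ
  | μ, i + 1 => lam μ (i + 1)

/-- The conditions on the sequences `λ^{(0)}, …, λ^{(n)}` that are summed over. -/
structure IsAdmissible (n : ℕ) (e : ℕ → ℕ) (L : ℕ) (lam : ℕ → ℕ → ℕ) : Prop where
  eq_zero : ∀ μ i, ¬ (μ ≤ n ∧ 1 ≤ i ∧ i ≤ e μ) → lam μ i = 0
  antitone : ∀ μ, μ ≤ n → ∀ i, 1 ≤ i → i < e μ → lam μ (i + 1) ≤ lam μ i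
  first_le : ∀ μ, 0 < μ → μ ≤ n → part e L lam μ 1 ≤ part e L lam μ 0
  wt_le : ∀ μ, μ ≤ n → wt e lam μ ≤ w e L lam μ
  wt_eq : wt e lam n = w e L lam n

theorem IsAdmissible.le {n : ℕ} {e : ℕ → ℕ} {L : ℕ} {lam : ℕ → ℕ → ℕ}
    (h : IsAdmissible n e L lam) (μ i : ℕ) : lam μ i ≤ L / 2 := by
  have part_le : ∀ μ i, μ ≤ n → lam μ i ≤ w e L lam μ := by
    intro μ i hμ
    by_cases hi : 1 ≤ i ∧ i ≤ e μ
    · refine le_trans ?_ (h.wt_le μ hμ)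
      exact Finset.single_le_sum (f := fun i => lam μ i) (fun _ _ => Nat.zero_le _)
        (Finset.mem_Icc.2 hi)
    · rw [h.eq_zero μ i (fun hh => hi hh.2)]; exact Nat.zero_le _
  have w_le : ∀ μ, μ ≤ n → w e L lam μ ≤ L / 2 := by
    intro μ
    induction μ with
    | zero => intro _; exact le_rfl
    | succ k ih => intro hk; exact (part_le k (e k) (by omega)).trans (ih (by omega))
  by_cases hμ : μ ≤ n
  · exact (part_le μ i hμ).trans (w_le μ hμ)
  · rw [h.eq_zero μ i (fun hh => hμ hh.1)]; exact Nat.zero_le _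

theorem finite_isAdmissible (n : ℕ) (e : ℕ → ℕ) (L : ℕ) :
    {lam : ℕ → ℕ → ℕ | IsAdmissible n e L lam}.Finite := by
  let M := ∑ μ ∈ Finset.range (n + 1), e μ
  let f : (ℕ → ℕ → ℕ) → (Fin (n + 1) → Fin (M + 1) → Fin (L / 2 + 1)) :=
    fun lam μ i => ⟨min (lam μ i) (L / 2), by omega⟩
  refine Set.Finite.of_finite_image (f := f) (Set.toFinite _) ?_
  intro x hx y hy hxy
  funext μ i
  by_cases hi : μ ≤ n ∧ 1 ≤ i ∧ i ≤ e μ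
  · have hM : e μ ≤ M := Finset.single_le_sum (f := e) (fun _ _ => Nat.zero_le _)
      (Finset.mem_range.2 (by omega))
    have := congrArg Fin.val
      (congrFun (congrFun hxy ⟨μ, by omega⟩) ⟨i, by omega⟩)
    simp only [f] at this
    rwa [min_eq_left (hx.le μ i), min_eq_left (hy.le μ i)] at this
  · rw [hx.eq_zero μ i hi, hy.eq_zero μ i hi]

/-- The finite set of sequences of partitions that are summed over. -/
def admissible (n : ℕ) (e : ℕ → ℕ) (L : ℕ) : Finset (ℕ → ℕ → ℕ) :=
  (finite_isAdmissible n e L).toFinset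

end PathGen

end

noncomputable section

namespace PathGen

open Finset

/-! ### Gaussian polynomials over `ℚ[X]`: Vandermonde and Pfaff–Saalschütz. -/

section GaussPoly

open Polynomial

/-! Both sides are identified with one alternating sum over `ℤ`, the bosonic polynomial `ypoly p p'
r₀ s₀ (L/2)`.

Path side. Deleting the last vertex of a path gives a two-term recurrence for `chi`. The alternating
sums `bpoly` satisfy the same recurrence by the two q-Pascal rules, have the same initial values,
and vanish on the walls `b = 0` and `b = p'` because their terms cancel under a reflection of the
summation index. Hence `chi` equals `bpoly` (`chi_eq_bpoly`), and for `a = b = s₀`, `c = s₀ + 1` the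
relation `|p s₀ - p' r₀| = 1` turns this into `ypoly` (`chi_eq_ypoly`).

Partition side. `ypoly` is refined to a polynomial `xpoly` with two bounds `N`, `M`, which admits
two operations. Burge's transform (`xpoly_burge`), termwise an instance of q-Pfaff–Saalschütz, sends
`(p, p')` to `(p, p' + p)`, that is `p'/p` to `p'/p + 1`; the exchange of `N` and `M` (`xpoly_swap`)
inverts `p'/p`. The sum over partitions has matching operations: splitting off the first part of
`λ⁽⁰⁾` is a Burge transform, and dropping an empty `λ⁽⁰⁾` exchanges the bounds. Starting from `p'/p
= 2`, where both sides are the delta function at `N = 0`, induction along the continued fraction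
proves the doubly bounded identity (`exists_sum_fterm`). One last transform, in its form for `M → ∞`
(`sum_xpoly`), yields `ypoly`; it has no Gaussian factor, which is why the factor `i = 1`, `μ = 0`
is absent from the theorem.

The pair `(r, s)` carried along keeps determinant `±1` and stays in the box `2r ≤ p`, `2s ≤ p'`,
which forces it to be the least pair (`IsBurgePair.eq_of_isLeast`). -/

/-- Gaussian polynomials with natural number arguments. -/
def qb (n k : ℕ) : ℚ[X] := gaussPoly n k

theorem qb_mul {n k : ℕ} (h : k ≤ n) : qb n k * (qfac k * qfac (n - k)) = qfac n := by
  have := gaussPoly_mul (A := n) (B := k) (by positivity) (by exact_mod_cast h)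
  simpa [qb, ← Nat.cast_sub h] using this

theorem qb_eq_zero {n k : ℕ} (h : n < k) : qb n k = 0 := by
  rw [qb, gaussPoly, if_neg (by omega)]

theorem qb_zero_right (n : ℕ) : qb n 0 = 1 := by
  have := qb_mul (Nat.zero_le n)
  rw [qfac_zero, one_mul, Nat.sub_zero] at this
  exact mul_right_cancel₀ (qfac_ne_zero n) (by rw [this, one_mul])

theorem qb_symm {n k : ℕ} (h : k ≤ n) : qb n (n - k) = qb n k := by
  have h1 := qb_mul h
  have h2 := qb_mul (Nat.sub_le n k)
  rw [Nat.sub_sub_self h, mul_comm (qfac (n - k))] at h2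
  exact mul_right_cancel₀ (mul_ne_zero (qfac_ne_zero k) (qfac_ne_zero (n - k))) (h2.trans h1.symm)

theorem qb_succ_succ (n k : ℕ) :
    qb (n + 1) (k + 1) = qb n (k + 1) + X ^ (n - k) * qb n k := by
  rcases lt_trichotomy k n with h | rfl | h
  · obtain ⟨d, rfl⟩ := Nat.exists_eq_add_of_lt h
    have h1 := qb_mul (n := k + d + 1 + 1) (k := k + 1) (by omega)
    have h2 := qb_mul (n := k + d + 1) (k := k + 1) (by omega)
    have h3 := qb_mul (n := k + d + 1) (k := k) (by omega)
    rw [show k + d + 1 + 1 - (k + 1) = d + 1 by omega, qfac_succ (k + d + 1), qfac_succ k,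
      qfac_succ d] at h1
    rw [show k + d + 1 - (k + 1) = d by omega, qfac_succ k] at h2
    rw [show k + d + 1 - k = d + 1 by omega, qfac_succ d] at h3
    rw [show k + d + 1 - k = d + 1 by omega]
    have h0 : qfac k * (1 - X ^ (k + 1)) * (qfac d * (1 - X ^ (d + 1))) ≠ 0 := by
      rw [← qfac_succ, ← qfac_succ]
      exact mul_ne_zero (qfac_ne_zero _) (qfac_ne_zero _)
    refine mul_right_cancel₀ h0 ?_
    rw [h1]
    linear_combination (-(1 - X ^ (d + 1) : ℚ[X])) * h2 - X ^ (d + 1) * (1 - X ^ (k + 1)) * h3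
  · have h1 := qb_symm (n := k + 1) (k := k + 1) le_rfl
    have h2 := qb_symm (n := k) (k := k) le_rfl
    rw [Nat.sub_self, qb_zero_right] at h1 h2
    rw [← h1, ← h2, qb_eq_zero (Nat.lt_succ_self k)]
    simp
  · rw [qb_eq_zero (by omega), qb_eq_zero (by omega), qb_eq_zero h]
    simp

/-- The `q`-Vandermonde identity. -/
theorem qb_vandermonde (m n r : ℕ) :
    qb (m + n) r = ∑ x ∈ antidiagonal r, X ^ (x.1 * (n - x.2)) * qb m x.1 * qb n x.2 := by
  induction m generalizing r with
  | zero =>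
    rw [zero_add, sum_eq_single (0, r)]
    · simp [qb_zero_right]
    · rintro ⟨i, j⟩ _ h
      have : i ≠ 0 := by
        rintro rfl
        simp_all
      simp [qb_eq_zero (Nat.pos_of_ne_zero this)]
    · simp
  | succ m ih =>
    cases r with
    | zero => simp [qb_zero_right]
    | succ r =>
      rw [show m + 1 + n = m + n + 1 by ring, qb_succ_succ, ih, ih, Nat.antidiagonal_succ,
        sum_cons, sum_cons, sum_map, sum_map, add_assoc]
      simp only [qb_zero_right, mul_sum]
      congr 1
      rw [← sum_add_distrib]
      refine sum_congr rfl ?_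
      rintro ⟨i, j⟩ hij
      have hij : i + j = r := by simpa using hij
      simp only [Function.Embedding.prodMap, Function.Embedding.coeFn_mk, Prod.map,
        Nat.succ_eq_add_one, Function.Embedding.refl_apply]
      rw [qb_succ_succ]
      by_cases hi : i ≤ m
      · by_cases hj : j ≤ n
        · obtain ⟨c, rfl⟩ := Nat.exists_eq_add_of_le hi
          obtain ⟨d, rfl⟩ := Nat.exists_eq_add_of_le hj
          subst hij
          rw [show i + c + (j + d) - (i + j) = c + d by omega, show j + d - j = d by omega,
            show i + c - i = c by omega]
          ring
        · simp [qb_eq_zero (not_le.1 hj)]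
      · simp [qb_eq_zero (not_le.1 hi), qb_eq_zero (show m < i + 1 by omega)]

theorem qb_mul_qb {n k j : ℕ} (hj : j ≤ k) :
    qb n k * qb k j = qb n j * qb (n - j) (k - j) := by
  by_cases hk : k ≤ n
  · have h1 := qb_mul hk
    have h2 := qb_mul hj
    have h3 := qb_mul (hj.trans hk)
    have h4 := qb_mul (show k - j ≤ n - j by omega)
    rw [show n - j - (k - j) = n - k by omega] at h4
    refine mul_right_cancel₀ (mul_ne_zero (qfac_ne_zero j)
      (mul_ne_zero (qfac_ne_zero (k - j)) (qfac_ne_zero (n - k)))) ?_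
    calc qb n k * qb k j * (qfac j * (qfac (k - j) * qfac (n - k)))
        = qb n k * ((qb k j * (qfac j * qfac (k - j))) * qfac (n - k)) := by ring
      _ = qb n j * (qfac j * (qb (n - j) (k - j) * (qfac (k - j) * qfac (n - k)))) := by
        rw [h2, h1, h4, h3]
      _ = _ := by ring
  · rw [qb_eq_zero (not_le.1 hk), zero_mul]
    by_cases hjn : j ≤ n
    · rw [qb_eq_zero (show n - j < k - j by omega), mul_zero]
    · rw [qb_eq_zero (not_le.1 hjn), zero_mul]

/-- The `q`-Pfaff–Saalschütz identity. -/
theorem qb_saalschutz (x y a b : ℕ) :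
    ∑ k ∈ range (min a b + 1),
        X ^ ((a - k) * (b - k)) * qb (x + y + k) k * qb y (a - k) * qb x (b - k) =
      qb (x + a) b * qb (y + b) a := by
  -- `T j k` is the summand of a double sum whose two orders of summation give the two sides. On the
  -- left the first factor is expanded by Vandermonde with top `(y + b) + (x - (b - k))`; on the
  -- right Vandermonde is used once for each factor.
  set T : ℕ → ℕ → ℚ[X] := fun j k =>
    X ^ ((a - k) * (b - k)) * X ^ (j * (x - (b - j))) * qb (y + b) j * qb y (a - k) *
      qb x (b - k) * qb (x - (b - k)) (k - j) with hT
  have hl : ∀ k ∈ range (min a b + 1),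
      X ^ ((a - k) * (b - k)) * qb (x + y + k) k * qb y (a - k) * qb x (b - k) =
        ∑ j ∈ range (k + 1), T j k := by
    intro k hk
    have hk : k ≤ a ∧ k ≤ b := by
      rw [mem_range] at hk
      omega
    by_cases hx : b - k ≤ x
    · rw [show x + y + k = y + b + (x - (b - k)) by omega, qb_vandermonde,
        Nat.sum_antidiagonal_eq_sum_range_succ_mk, mul_sum, sum_mul, sum_mul]
      refine sum_congr rfl fun j hj => ?_
      have hj : j ≤ k := by
        rw [mem_range] at hj
        omega
      simp only [hT]
      by_cases hjx : k - j ≤ x - (b - k)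
      · rw [show x - (b - k) - (k - j) = x - (b - j) by omega]
        ring
      · rw [qb_eq_zero (not_le.1 hjx)]
        ring
    · simp [hT, qb_eq_zero (not_le.1 hx)]
  have hr : ∀ j ∈ range (min a b + 1),
      X ^ (j * (x - (b - j))) * qb a j * qb x (b - j) * qb (y + b) a =
        ∑ k ∈ Ico j (min a b + 1), T j k := by
    intro j hj
    have hj : j ≤ a ∧ j ≤ b := by
      rw [mem_range] at hj
      omega
    have h1 : qb (y + b) a * qb a j = qb (y + b) j * qb (y + (b - j)) (a - j) := by
      rw [qb_mul_qb hj.1, show y + b - j = y + (b - j) by omega]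
    calc X ^ (j * (x - (b - j))) * qb a j * qb x (b - j) * qb (y + b) a
        = X ^ (j * (x - (b - j))) * qb x (b - j) * (qb (y + b) a * qb a j) := by ring
      _ = ∑ i ∈ range (a - j + 1), X ^ (j * (x - (b - j))) * qb x (b - j) * (qb (y + b) j *
            (X ^ ((a - j - i) * (b - j - i)) * qb y (a - j - i) * qb (b - j) i)) := by
        rw [h1, qb_vandermonde y (b - j) (a - j), ← Nat.sum_antidiagonal_swap,
          Nat.sum_antidiagonal_eq_sum_range_succ_mk]
        simp only [mul_sum, Prod.swap]
      _ = ∑ i ∈ range (min a b + 1 - j), X ^ (j * (x - (b - j))) * qb x (b - j) *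
            (qb (y + b) j *
            (X ^ ((a - j - i) * (b - j - i)) * qb y (a - j - i) * qb (b - j) i)) := by
        symm
        refine sum_subset (range_subset_range.2 (by omega)) fun i hi hi' => ?_
        rw [mem_range] at hi hi'
        rw [qb_eq_zero (show b - j < i by omega)]
        ring
      _ = ∑ k ∈ Ico j (min a b + 1), T j k := by
        rw [sum_Ico_eq_sum_range]
        refine sum_congr rfl fun i hi => ?_
        rw [mem_range] at hi
        have h2 : qb x (b - j) * qb (b - j) i =
            qb x (b - (j + i)) * qb (x - (b - (j + i))) (j + i - j) := by
          rw [← qb_symm (show i ≤ b - j by omega), qb_mul_qb (by omega)]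
          congr 2 <;> omega
        simp only [hT]
        rw [show a - j - i = a - (j + i) by omega, show b - j - i = b - (j + i) by omega]
        linear_combination (X ^ (j * (x - (b - j))) * (qb (y + b) j *
            (X ^ ((a - (j + i)) * (b - (j + i))) * qb y (a - (j + i))))) * h2
  rw [sum_congr rfl hl, add_comm x a, qb_vandermonde, Nat.sum_antidiagonal_eq_sum_range_succ_mk,
    sum_mul]
  symm
  rw [← sum_subset (s₁ := range (min a b + 1)) (range_subset_range.2 (by omega))]
  · rw [sum_congr rfl hr]
    refine sum_comm' fun j k => ?_
    simp only [mem_range, mem_Ico]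
    omega
  · intro j hj hj'
    rw [mem_range] at hj hj'
    simp [qb_eq_zero (show a < j by omega)]

end GaussPoly

/-! ### Gaussian polynomials with integer arguments in `QPoly`. -/

theorem qpow_add (x y : ℚ) : qpow (x + y) = qpow x * qpow y := by
  simp [qpow, AddMonoidAlgebra.single_mul_single]

theorem qpow_zero : qpow 0 = 1 := rfl

theorem qpow_pow (x : ℚ) (n : ℕ) : qpow x ^ n = qpow (n * x) := by
  simp [qpow, AddMonoidAlgebra.single_pow]

theorem gauss_eq_zero {A B : ℤ} (h : B < 0 ∨ A < B) : gauss A B = 0 := by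
  rw [gauss, gaussPoly, if_neg (by omega), map_zero]

theorem gauss_natCast (n k : ℕ) : gauss n k = Polynomial.aeval (qpow 1) (qb n k) := rfl

theorem aeval_X_pow (n : ℕ) :
    Polynomial.aeval (qpow 1) (Polynomial.X ^ n : Polynomial ℚ) = qpow n := by
  simp [qpow_pow]

theorem gauss_zero_right {A : ℤ} (h : 0 ≤ A) : gauss A 0 = 1 := by
  lift A to ℕ using h
  have := gauss_natCast A 0
  rw [qb_zero_right, map_one] at this
  exact_mod_cast this

theorem gauss_symm (A B : ℤ) : gauss A (A - B) = gauss A B := by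
  by_cases h : 0 ≤ B ∧ B ≤ A
  · obtain ⟨h0, h1⟩ := h
    lift B to ℕ using h0
    lift A to ℕ using by omega
    rw [← Nat.cast_sub (by omega), gauss_natCast, gauss_natCast, qb_symm (by omega)]
  · rw [gauss_eq_zero (by omega), gauss_eq_zero (by omega)]

theorem gauss_pascal {A : ℤ} (hA : 0 ≤ A) (B : ℤ) :
    gauss (A + 1) B = gauss A B + qpow (A + 1 - B) * gauss A (B - 1) := by
  rcases lt_trichotomy B 0 with h | rfl | h
  · simp [gauss_eq_zero (Or.inl h), gauss_eq_zero (A := A) (B := B - 1) (by omega)]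
  · rw [gauss_zero_right hA, gauss_zero_right (by omega), gauss_eq_zero (by omega), mul_zero,
      add_zero]
  · lift A to ℕ using hA
    obtain ⟨k, rfl⟩ : ∃ k : ℕ, B = k + 1 := ⟨(B - 1).toNat, by omega⟩
    have := congrArg (Polynomial.aeval (qpow 1)) (qb_succ_succ A k)
    rw [map_add, map_mul, aeval_X_pow, ← gauss_natCast, ← gauss_natCast, ← gauss_natCast] at this
    rw [add_sub_cancel_right]
    push_cast at this ⊢
    rw [this]
    by_cases hk : k ≤ A
    · congr 3
      push_cast [Nat.cast_sub hk]
      ring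
    · rw [gauss_eq_zero (A := A) (B := k) (by omega), mul_zero, mul_zero]

theorem gauss_pascal' {A : ℤ} (hA : 0 ≤ A) (B : ℤ) :
    gauss (A + 1) B = qpow B * gauss A B + gauss A (B - 1) := by
  rw [← gauss_symm, gauss_pascal hA, show A + 1 - B - 1 = A - B by ring, gauss_symm,
    show A + 1 - B = A - (B - 1) by ring, gauss_symm]
  rw [show ((A : ℚ) + 1 - ((A - (B - 1) : ℤ) : ℚ)) = B by push_cast; ring, add_comm]

theorem gauss_saalschutz {x y a b : ℤ} (hx : 0 ≤ x) (hy : 0 ≤ y) (ha : 0 ≤ a) (hb : 0 ≤ b)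
    {n : ℕ} (hn : a ≤ n ∨ b ≤ n) :
    ∑ k ∈ range (n + 1), qpow ((a - k) * (b - k)) * gauss (x + y + k) k * gauss y (a - k) *
      gauss x (b - k) = gauss (x + a) b * gauss (y + b) a := by
  lift x to ℕ using hx
  lift y to ℕ using hy
  lift a to ℕ using ha
  lift b to ℕ using hb
  have := congrArg (Polynomial.aeval (qpow 1)) (qb_saalschutz x y a b)
  rw [map_mul, ← gauss_natCast, ← gauss_natCast, map_sum] at this
  push_cast at this
  rw [← this]
  refine (sum_subset (s₁ := range (min a b + 1)) (range_subset_range.2 (by omega))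
    fun k _ hk => ?_).symm.trans (sum_congr rfl fun k hk => ?_)
  · rw [mem_range] at hk
    by_cases hka : a < k
    · rw [gauss_eq_zero (A := y) (B := a - k) (by omega)]
      ring
    · rw [gauss_eq_zero (A := x) (B := b - k) (by omega)]
      ring
  · rw [mem_range] at hk
    rw [map_mul, map_mul, map_mul, aeval_X_pow, ← gauss_natCast, ← gauss_natCast, ← gauss_natCast]
    push_cast [Nat.cast_sub (show k ≤ a by omega), Nat.cast_sub (show k ≤ b by omega)]
    rfl

theorem gauss_vandermonde {x y r : ℤ} (hx : 0 ≤ x) (hy : 0 ≤ y) (hr : 0 ≤ r) {n : ℕ}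
    (hn : r ≤ n) :
    ∑ k ∈ range (n + 1), qpow (k * (y - (r - k))) * gauss x k * gauss y (r - k) =
      gauss (x + y) r := by
  lift x to ℕ using hx
  lift y to ℕ using hy
  lift r to ℕ using hr
  have := congrArg (Polynomial.aeval (qpow 1)) (qb_vandermonde x y r)
  rw [← gauss_natCast, map_sum, Nat.sum_antidiagonal_eq_sum_range_succ_mk] at this
  push_cast at this
  rw [this]
  refine (sum_subset (s₁ := range (r + 1)) (range_subset_range.2 (by omega))
    fun k _ hk => ?_).symm.trans (sum_congr rfl fun k hk => ?_)
  · rw [mem_range] at hk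
    rw [gauss_eq_zero (A := y) (B := r - k) (by omega)]
    ring
  · rw [mem_range] at hk
    rw [map_mul, map_mul, aeval_X_pow, ← gauss_natCast, ← gauss_natCast]
    push_cast [Nat.cast_sub (show k ≤ r by omega)]
    by_cases h : r - k ≤ y
    · push_cast [Nat.cast_sub h, Nat.cast_sub (show k ≤ r by omega)]
      rfl
    · rw [gauss_eq_zero (A := y) (B := r - k) (by omega)]
      ring

/-! ### Burge's summation formula and its limit. -/

/-- The product of two Gaussian polynomials occurring in Burge's summation formula. -/
def gprod (N M v t : ℤ) : QPoly :=
  gauss (N + M + v + t) (M + t) * gauss (N + M - v - t) (M - t)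

theorem gprod_swap (N M v t : ℤ) : gprod N M v t = gprod M N t v := by
  rw [gprod, gprod, ← gauss_symm, ← gauss_symm (N + M - v - t)]
  congr 2 <;> ring

theorem gprod_neg (N M v t : ℤ) : gprod N M (-v) (-t) = gprod N M v t := by
  rw [gprod, gprod, mul_comm]
  congr 2 <;> ring

theorem gprod_eq_zero {N M v t : ℤ} (h : N < |v| ∨ M < |t|) : gprod N M v t = 0 := by
  simp only [lt_abs] at h
  rw [gprod]
  by_cases h1 : M + t < 0 ∨ N + M + v + t < M + t
  · rw [gauss_eq_zero h1, zero_mul]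
  · rw [gauss_eq_zero (A := N + M - v - t) (B := M - t) (by omega), mul_zero]

/-- Burge's summation formula. -/
theorem sum_gprod (N M : ℕ) {v t : ℤ} (h : v * t ≤ 0) :
    ∑ k ∈ range (N + 1), qpow ((k : ℚ) ^ 2) *
      (gauss (2 * N + M - k) (M - k) * gprod (N - k) k v t) =
      qpow ((t : ℚ) ^ 2) * gprod N M (v - t) t := by
  by_cases hz : (N : ℤ) < |v - t| ∨ (M : ℤ) < |t|
  · rw [gprod_eq_zero hz, mul_zero]
    refine sum_eq_zero fun k hk => ?_
    by_cases hk1 : (k : ℤ) ≤ M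
    · rw [gprod_eq_zero, mul_zero, mul_zero]
      by_contra hcon
      simp only [lt_abs] at hz hcon
      omega
    · rw [gauss_eq_zero (by omega), zero_mul, mul_zero]
  -- Since `v t ≤ 0`, `(v + t)² ≤ (v - t)²`. This makes the Saalschütz parameters `N ± (v + t)`
  -- nonnegative.
  · have hv : |v + t| ≤ N ∧ |t| ≤ M := by
      rw [not_or, not_lt, not_lt] at hz
      refine ⟨?_, hz.2⟩
      refine le_trans (sq_le_sq.1 ?_) hz.1
      nlinarith
    have hv1 := abs_le.1 hv.1
    have hv2 := abs_le.1 hv.2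
    rw [not_or, not_lt, not_lt, abs_le] at hz
    have key := gauss_saalschutz (x := N + v + t) (y := N - v - t) (a := M - t) (b := M + t)
      (by omega) (by omega) (by omega) (by omega) (n := M) (by omega)
    -- The Saalschütz index is `M - k`, so the sum is reversed before the terms are compared.
    rw [← sum_range_reflect] at key
    rw [gprod, show (N : ℤ) + M + (v - t) + t = N + v + t + (M - t) by ring,
      show (N : ℤ) + M - (v - t) - t = N - v - t + (M + t) by ring, ← key, mul_sum]
    have h1 : ∀ k ∈ range (N + M + 1), k ∉ range (N + 1) → qpow ((k : ℚ) ^ 2) *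
      (gauss (2 * N + M - k) (M - k) * gprod (N - k) k v t) = 0 := by
      intro k _ hk
      rw [mem_range] at hk
      rw [gprod_eq_zero (Or.inl (by have := abs_nonneg v; omega)), mul_zero, mul_zero]
    have h2 : ∀ k ∈ range (N + M + 1), k ∉ range (M + 1) → qpow ((k : ℚ) ^ 2) *
      (gauss (2 * N + M - k) (M - k) * gprod (N - k) k v t) = 0 := by
      intro k _ hk
      rw [mem_range] at hk
      rw [gauss_eq_zero (by omega), zero_mul, mul_zero]
    rw [sum_subset (range_subset_range.2 (by omega)) h1,
      ← sum_subset (range_subset_range.2 (by omega)) h2]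
    refine sum_congr rfl fun k hk => ?_
    rw [mem_range] at hk
    rw [show M + 1 - 1 - k = M - k by omega, Nat.cast_sub (by omega), Nat.cast_sub (by omega),
      gprod, show (k : ℚ) ^ 2 = t ^ 2 + (((M - t : ℤ) : ℚ) - (M - k)) *
        (((M + t : ℤ) : ℚ) - (M - k)) by push_cast; ring, qpow_add,
      show (N : ℤ) + v + t + (N - v - t) + (M - k) = 2 * N + M - k by ring,
      show (M : ℤ) - t - (M - k) = k - t by ring, show (M : ℤ) + t - (M - k) = k + t by ring,
      show (N : ℤ) - k + k + v + t = N + v + t by ring,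
      show (N : ℤ) - k + k - v - t = N - v - t by ring]
    ring

/-- The limit `M → ∞` of `sum_gprod`, after multiplication by `(1-q)⋯(1-q^{2N})`; it is proved
directly from Vandermonde instead of Saalschütz. -/
theorem sum_gprod_limit (N : ℕ) {v t : ℤ} (h : v * t ≤ 0) :
    ∑ k ∈ range (N + 1), qpow ((k : ℚ) ^ 2) * gprod (N - k) k v t =
      qpow ((t : ℚ) ^ 2) * gauss (2 * N) (N - (v - t)) := by
  wlog ht : 0 ≤ t generalizing v t
  · have := this (v := -v) (t := -t) (by linarith) (by omega)
    simp only [gprod_neg] at this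
    rw [this, ← gauss_symm]
    push_cast
    congr 2 <;> ring
  by_cases hz : (N : ℤ) < |v - t|
  · rw [gauss_eq_zero (by rw [lt_abs] at hz; omega), mul_zero]
    refine sum_eq_zero fun k hk => ?_
    rw [gprod_eq_zero, mul_zero]
    by_contra hcon
    simp only [lt_abs] at hz hcon
    omega
  rw [not_lt] at hz
  have hv1 : |v + t| ≤ N := le_trans (sq_le_sq.1 (by nlinarith)) hz
  rw [abs_le] at hz hv1
  lift t to ℕ using ht
  have key := gauss_vandermonde (x := N + v + t) (y := N - v - t) (r := N - v + t)
      (by omega) (by omega) (by omega) (n := t + (N + v.natAbs)) (by omega)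
  -- The Vandermonde index is `t + k`; its first `t` terms vanish.
  rw [add_assoc, sum_range_add, sum_eq_zero, zero_add] at key
  · rw [show (2 : ℤ) * N = N + v + t + (N - v - t) by ring,
      show (N : ℤ) - (v - t) = N - v + t by ring, ← key, mul_sum]
    refine (sum_subset (range_subset_range.2 (by omega)) fun k _ hk => ?_).trans
      (sum_congr rfl fun k hk => ?_)
    · rw [mem_range] at hk
      rw [gprod_eq_zero (Or.inl (by have := abs_nonneg v; omega)), mul_zero]
    · rw [gprod, show (k : ℚ) ^ 2 = (t : ℤ) ^ 2 + ((t + k : ℕ) : ℚ) *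
        (((N - v - t : ℤ) : ℚ) - ((N - v + t : ℤ) - (t + k : ℕ))) by push_cast; ring, qpow_add,
        show (N : ℤ) - k + k + v + t = N + v + t by ring,
        show (N : ℤ) - k + k - v - t = N - v - t by ring, ← gauss_symm (N - v - t)]
      push_cast
      rw [add_comm (t : ℤ) k, show (N : ℤ) - v - t - (k - t) = N - v + t - (k + t) by ring]
      ring
  · intro k hk
    rw [mem_range] at hk
    rw [gauss_eq_zero (A := N - v - t) (by omega), mul_zero]

/-! ### Bosonic polynomials and Burge's transform. -/

/-- The summand of `xpoly`. -/
def xterm (p p' r s N M l : ℤ) : QPoly :=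
  qpow ((p : ℚ) * p' * l ^ 2 + l) * gprod N M (p' * l) (-(p * l)) -
    qpow (((p' : ℚ) * l + s) * (p * l + r)) * gprod N M (p' * l + s) (-(p * l + r))

/-- The doubly finite bosonic polynomials on which Burge's transform acts. -/
def xpoly (p p' r s N M : ℤ) : QPoly := ∑ᶠ l : ℤ, xterm p p' r s N M l

/-- The summand of `ypoly`. -/
def yterm (p p' r s N l : ℤ) : QPoly :=
  qpow ((p : ℚ) * p' * l ^ 2 + l) * gauss (2 * N) (N - p' * l) -
    qpow (((p' : ℚ) * l + s) * (p * l + r)) * gauss (2 * N) (N - (p' * l + s))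

/-- The finitized bosonic character. -/
def ypoly (p p' r s N : ℤ) : QPoly := ∑ᶠ l : ℤ, yterm p p' r s N l

theorem xpoly_swap (p p' r s N M : ℤ) : xpoly p' p s r M N = xpoly p p' r s N M := by
  refine finsum_congr fun l => ?_
  rw [xterm, xterm, gprod_swap, gprod_swap M N, ← gprod_neg, ← gprod_neg N M (-(p' * l + s)),
    neg_neg, neg_neg, mul_comm (p : ℚ) p', mul_comm ((p : ℚ) * l + r)]

theorem lt_abs_mul_add {a l s N : ℤ} (ha : 0 < a) (h : N + |s| < |l|) : N < |a * l + s| := by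
  have h1 : |l| ≤ |a * l| := by
    rw [abs_mul, abs_of_pos ha]
    nlinarith [abs_nonneg l]
  have h2 : |a * l| ≤ |a * l + s| + |s| := by
    simpa using abs_sub (a * l + s) s
  linarith

theorem finite_support_of_abs {f : ℤ → QPoly} (K : ℤ) (h : ∀ l, K < |l| → f l = 0) :
    f.support.Finite := by
  refine (Set.finite_Icc (-K) K).subset fun l hl => ?_
  rw [Set.mem_Icc, ← abs_le]
  exact not_lt.1 fun hK => hl (h l hK)

theorem finite_support_xterm {p p' r s N M : ℤ} (hp' : 0 < p') :
    (xterm p p' r s N M).support.Finite := by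
  refine finite_support_of_abs (N + |s|) fun l hl => ?_
  rw [xterm, gprod_eq_zero (Or.inl (lt_abs_mul_add hp' hl)), gprod_eq_zero (Or.inl ?_)]
  · ring
  · simpa using lt_abs_mul_add (s := 0) (N := N) hp' (by rw [abs_zero]; linarith [abs_nonneg s])

/-- Supplies the sign condition of Burge's formula for both families of terms: with `(r, s)` in the
box, `p' l + s` and `p l + r` never have strictly opposite signs. -/
theorem xterm_mul_nonpos {p p' r s : ℤ} (hp : 0 < p) (hp' : 0 < p') (hr : 0 ≤ r) (hrp : r ≤ p)
    (hs : 0 ≤ s) (hsp : s ≤ p') (l : ℤ) :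
    (p' * l) * (-(p * l)) ≤ 0 ∧ (p' * l + s) * (-(p * l + r)) ≤ 0 := by
  constructor
  · have := mul_nonneg (mul_pos hp hp').le (sq_nonneg l)
    linarith
  · rcases le_or_gt 0 l with h | h
    · have := mul_nonneg (add_nonneg (mul_nonneg hp'.le h) hs) (add_nonneg (mul_nonneg hp.le h) hr)
      linarith
    · refine mul_nonpos_of_nonpos_of_nonneg ?_ ?_ <;> nlinarith

/-- Burge's transform of the bosonic polynomials. -/
theorem xpoly_burge {p p' r s : ℤ} (hp : 0 < p) (hp' : 0 < p') (hr : 0 ≤ r) (hrp : r ≤ p)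
    (hs : 0 ≤ s) (hsp : s ≤ p') (N M : ℕ) :
    ∑ k ∈ range (N + 1), qpow ((k : ℚ) ^ 2) *
      (gauss (2 * N + M - k) (M - k) * xpoly p p' r s (N - k) k) =
      xpoly p (p' + p) r (s + r) N M := by
  simp only [xpoly, mul_finsum]
  rw [← finsum_sum_comm]
  · refine finsum_congr fun l => ?_
    obtain ⟨h1, h2⟩ := xterm_mul_nonpos hp hp' hr hrp hs hsp l
    have e1 := sum_gprod N M h1
    have e2 := sum_gprod N M h2
    calc _ = qpow ((p : ℚ) * p' * l ^ 2 + l) * (∑ k ∈ range (N + 1), qpow ((k : ℚ) ^ 2) *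
          (gauss (2 * N + M - k) (M - k) * gprod (N - k) k (p' * l) (-(p * l)))) -
          qpow (((p' : ℚ) * l + s) * (p * l + r)) * (∑ k ∈ range (N + 1), qpow ((k : ℚ) ^ 2) *
          (gauss (2 * N + M - k) (M - k) * gprod (N - k) k (p' * l + s) (-(p * l + r)))) := by
          rw [mul_sum, mul_sum, ← sum_sub_distrib]
          refine sum_congr rfl fun k _ => ?_
          rw [xterm]
          ring
      _ = _ := by
        rw [e1, e2, xterm, ← mul_assoc, ← mul_assoc, ← qpow_add, ← qpow_add]
        congr 3
        · push_cast; ring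
        · ring
        · push_cast; ring
        · ring
  · intro k _
    exact (finite_support_xterm (p := p) (r := r) (s := s) (N := N - k) (M := k) hp').subset
      fun l hl h => hl (by simp [h])

theorem sum_xpoly {p p' r s : ℤ} (hp : 0 < p) (hp' : 0 < p') (hr : 0 ≤ r) (hrp : r ≤ p)
    (hs : 0 ≤ s) (hsp : s ≤ p') (N : ℕ) :
    ∑ k ∈ range (N + 1), qpow ((k : ℚ) ^ 2) * xpoly p p' r s (N - k) k =
      ypoly p (p' + p) r (s + r) N := by
  simp only [xpoly, ypoly, mul_finsum]
  rw [← finsum_sum_comm]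
  · refine finsum_congr fun l => ?_
    obtain ⟨h1, h2⟩ := xterm_mul_nonpos hp hp' hr hrp hs hsp l
    have e1 := sum_gprod_limit N h1
    have e2 := sum_gprod_limit N h2
    calc _ = qpow ((p : ℚ) * p' * l ^ 2 + l) * (∑ k ∈ range (N + 1), qpow ((k : ℚ) ^ 2) *
          gprod (N - k) k (p' * l) (-(p * l))) -
          qpow (((p' : ℚ) * l + s) * (p * l + r)) * (∑ k ∈ range (N + 1), qpow ((k : ℚ) ^ 2) *
          gprod (N - k) k (p' * l + s) (-(p * l + r))) := by
          rw [mul_sum, mul_sum, ← sum_sub_distrib]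
          refine sum_congr rfl fun k _ => ?_
          rw [xterm]
          ring
      _ = _ := by
        rw [e1, e2, yterm, ← mul_assoc, ← mul_assoc, ← qpow_add, ← qpow_add]
        congr 3
        · push_cast; ring
        · ring
        · push_cast; ring
        · ring
  · intro k _
    exact (finite_support_xterm (p := p) (r := r) (s := s) (N := N - k) (M := k) hp').subset
      fun l hl h => hl (by simp [h])

/-- The common cancellation principle: with a shift of `ℤ` it telescopes `xpoly 1 1 0 1`, with a
reflection it kills `bpoly` on the walls. -/
theorem finsum_sub_comp_equiv {f : ℤ → QPoly} (hf : f.support.Finite) (e : ℤ ≃ ℤ) :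
    ∑ᶠ l, (f l - f (e l)) = 0 := by
  rw [finsum_sub_distrib hf, finsum_comp_equiv e, sub_self]
  exact hf.preimage e.injective.injOn

/-- Applying a Pascal rule to one factor in each product puts the summand in the form `f l - f (l +
1)`, ready to telescope. -/
theorem xterm_one_one {N M : ℤ} (h : 1 ≤ N + M) (l : ℤ) :
    xterm 1 1 0 1 N M l =
      qpow ((N : ℚ) + l ^ 2) * gauss (N + M) (M - l) * gauss (N + M - 1) (M + l - 1) -
      qpow ((N : ℚ) + ((l + 1 : ℤ) : ℚ) ^ 2) * gauss (N + M) (M - (l + 1)) *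
        gauss (N + M - 1) (M + (l + 1) - 1) := by
  have h1 := gauss_pascal (A := N + M) (by omega) (M - l)
  have h2 := gauss_pascal (A := N + M - 1) (by omega) (M + l)
  rw [sub_add_cancel] at h2
  rw [xterm, gprod, gprod, show N + M + 1 * l + -(1 * l) = N + M by ring,
    show N + M - 1 * l - -(1 * l) = N + M by ring,
    show N + M + (1 * l + 1) + -(1 * l + 0) = N + M + 1 by ring,
    show N + M - (1 * l + 1) - -(1 * l + 0) = N + M - 1 by ring,
    show M + -(1 * l) = M - l by ring, show M - -(1 * l) = M + l by ring,
    show M + -(1 * l + 0) = M - l by ring, show M - -(1 * l + 0) = M + l by ring, h1,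
    show M + (l + 1) - 1 = M + l by ring, show M - (l + 1) = M - l - 1 by ring,
    show (((1 : ℤ) : ℚ) * l + (1 : ℤ)) * ((1 : ℤ) * l + (0 : ℤ)) =
      ((1 : ℤ) : ℚ) * (1 : ℤ) * l ^ 2 + l by push_cast; ring]
  have q1 : qpow ((N : ℚ) + l ^ 2) = qpow (((1 : ℤ) : ℚ) * (1 : ℤ) * l ^ 2 + l) *
      qpow (((N + M - 1 : ℤ) : ℚ) + 1 - (M + l : ℤ)) := by
    rw [← qpow_add]
    congr 1
    push_cast
    ring
  have q2 : qpow ((N : ℚ) + ((l + 1 : ℤ) : ℚ) ^ 2) =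
      qpow (((1 : ℤ) : ℚ) * (1 : ℤ) * l ^ 2 + l) *
      qpow (((N + M : ℤ) : ℚ) + 1 - (M - l : ℤ)) := by
    rw [← qpow_add]
    congr 1
    push_cast
    ring
  rw [q1, q2]
  linear_combination
    qpow (((1 : ℤ) : ℚ) * (1 : ℤ) * l ^ 2 + l) * gauss (N + M) (M - l) * h2

theorem xpoly_one_one {N M : ℤ} (hN : 0 ≤ N) (hM : 0 ≤ M) :
    xpoly 1 1 0 1 N M = if N = 0 ∧ M = 0 then 1 else 0 := by
  split_ifs with h
  · obtain ⟨rfl, rfl⟩ := h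
    rw [xpoly, finsum_eq_single _ 0]
    · simp [xterm, gprod, gauss_zero_right, qpow_zero,
        gauss_eq_zero (A := -1) (B := 0) (by omega)]
    · intro l hl
      rw [xterm, gprod_eq_zero (Or.inl (by simpa using hl)),
        gprod_eq_zero (Or.inr (by simpa using hl))]
      ring
  · rw [xpoly, finsum_congr (xterm_one_one (by omega))]
    refine finsum_sub_comp_equiv (f := fun l : ℤ => qpow ((N : ℚ) + l ^ 2) *
      gauss (N + M) (M - l) * gauss (N + M - 1) (M + l - 1)) ?_ (Equiv.addRight 1)
    refine finite_support_of_abs M fun l hl => ?_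
    rcases lt_abs.1 hl with h | h
    · rw [gauss_eq_zero (A := N + M) (B := M - l) (by omega), mul_zero, zero_mul]
    · rw [gauss_eq_zero (A := N + M - 1) (by omega), mul_zero]

theorem gauss_self {A : ℤ} (h : 0 ≤ A) : gauss A A = 1 := by
  rw [← gauss_symm, sub_self, gauss_zero_right h]

/-- One Burge transform from `(1, 1)`, where only `N - k = k = 0` survives. The induction starts
here because `(r, s) = (0, 1)` violates `2s ≤ p'` for `p' = 1`; this is the source of the `2` in the
entry `e_n + 2`. -/
theorem xpoly_one_two (N M : ℕ) : xpoly 1 2 0 1 N M = if N = 0 then 1 else 0 := by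
  have := xpoly_burge (p := 1) (p' := 1) (r := 0) (s := 1) (by norm_num) (by norm_num)
    (by norm_num) (by norm_num) (by norm_num) (by norm_num) N M
  rw [show (1 : ℤ) + 1 = 2 by norm_num, show (1 : ℤ) + 0 = 1 by norm_num] at this
  rw [← this]
  split_ifs with h
  · subst h
    simp [xpoly_one_one, qpow_zero, gauss_self]
  · refine sum_eq_zero fun k hk => ?_
    rw [mem_range] at hk
    rw [xpoly_one_one (by omega) (by omega), if_neg (by omega), mul_zero, mul_zero]

theorem ypoly_one_two (N : ℕ) : ypoly 1 2 0 1 N = if N = 0 then 1 else 0 := by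
  have := sum_xpoly (p := 1) (p' := 1) (r := 0) (s := 1) (by norm_num) (by norm_num)
    (by norm_num) (by norm_num) (by norm_num) (by norm_num) N
  rw [show (1 : ℤ) + 1 = 2 by norm_num, show (1 : ℤ) + 0 = 1 by norm_num] at this
  rw [← this]
  split_ifs with h
  · subst h
    simp [xpoly_one_one, qpow_zero]
  · refine sum_eq_zero fun k hk => ?_
    rw [mem_range] at hk
    rw [xpoly_one_one (by omega) (by omega), if_neg (by omega), mul_zero]

/-! ### Paths and the recurrence from deleting the last vertex. -/

theorem mem_paths {p' : ℕ} {a b : ℤ} {L : ℕ} {h : Fin (L + 1) → ℤ} :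
    h ∈ paths p' a b L ↔ (∀ i, 1 ≤ h i ∧ h i ≤ (p' : ℤ) - 1) ∧ h 0 = a ∧ h (Fin.last L) = b ∧
      ∀ i : Fin L, h i.succ = h i.castSucc + 1 ∨ h i.succ = h i.castSucc - 1 := by
  simp [paths, Fintype.mem_piFinset]

theorem phi_eq_zero {p p' : ℕ} {a b c : ℤ} {L : ℕ} (h : b < 1 ∨ (p' : ℤ) - 1 < b) :
    phi p p' a b c L = 0 := by
  refine sum_eq_zero fun g hg => ?_
  rw [mem_paths] at hg
  have := hg.1 (Fin.last L)
  rw [hg.2.2.1] at this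
  omega

theorem phi_zero (p p' : ℕ) (a b c : ℤ) (ha : 1 ≤ a) (ha' : a ≤ (p' : ℤ) - 1) :
    phi p p' a b c 0 = if a = b then 1 else 0 := by
  split_ifs with h
  · subst h
    rw [phi, sum_eq_single fun _ => a]
    · simp [pathWeight, qpow_zero]
    · intro g hg hne
      rw [mem_paths] at hg
      exact absurd (funext fun i => by rw [Fin.fin_one_eq_zero i, ← hg.2.1]) hne
    · intro hn
      exact absurd (mem_paths.2 (by simp [ha, ha'])) hn
  · refine sum_eq_zero fun g hg => ?_
    rw [mem_paths] at hg
    exact absurd (hg.2.1.symm.trans hg.2.2.1) h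

theorem snoc_mem_paths {p' : ℕ} {a b d : ℤ} {L : ℕ} (hb : 1 ≤ b) (hb' : b ≤ (p' : ℤ) - 1)
    (hd : b = d + 1 ∨ b = d - 1) {g : Fin (L + 1) → ℤ} (hg : g ∈ paths p' a d L) :
    (Fin.snoc g b : Fin (L + 2) → ℤ) ∈ paths p' a b (L + 1) := by
  rw [mem_paths] at hg ⊢
  obtain ⟨h1, h2, h3, h4⟩ := hg
  refine ⟨fun i => ?_, ?_, by simp, fun i => ?_⟩
  · refine Fin.lastCases ?_ (fun j => ?_) i
    · simpa using ⟨hb, Int.lt_of_le_sub_one hb'⟩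
    · simpa using h1 j
  · rw [← Fin.castSucc_zero]
    simpa using h2
  · refine Fin.lastCases ?_ (fun j => ?_) i
    · simpa [h3] using hd
    · rw [Fin.succ_castSucc, Fin.snoc_castSucc (α := fun _ => ℤ),
        Fin.snoc_castSucc (α := fun _ => ℤ)]
      exact h4 j

theorem init_mem_paths {p' : ℕ} {a b : ℤ} {L : ℕ} {h : Fin (L + 2) → ℤ}
    (hh : h ∈ paths p' a b (L + 1)) :
    (Fin.init h : Fin (L + 1) → ℤ) ∈ paths p' a (h (Fin.last L).castSucc) L := by
  rw [mem_paths] at hh ⊢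
  obtain ⟨h1, h2, h3, h4⟩ := hh
  refine ⟨fun i => h1 _, by simpa [Fin.init] using h2, rfl, fun i => ?_⟩
  have := h4 i.castSucc
  rwa [Fin.succ_castSucc] at this

theorem height_snoc {L : ℕ} {b c : ℤ} {g : Fin (L + 1) → ℤ} {i : ℕ} (hi : i ≤ L + 1) :
    height (L + 1) c (Fin.snoc g b : Fin (L + 2) → ℤ) i = height L b g i := by
  rw [height, height, dif_pos (by omega)]
  split_ifs with h
  · exact Fin.snoc_castSucc (α := fun _ => ℤ) b g ⟨i, h⟩
  · obtain rfl : i = L + 1 := by omega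
    exact Fin.snoc_last (α := fun _ => ℤ) b g

/-- The old endpoint `b` becomes the exterior height of the truncated path, so the earlier local
weights are unchanged. -/
theorem pathWeight_snoc (p p' L : ℕ) (b c : ℤ) (g : Fin (L + 1) → ℤ) :
    pathWeight p p' (L + 1) c (Fin.snoc g b : Fin (L + 2) → ℤ) =
      pathWeight p p' L b g + (L + 1) * localWeight p p' (g (Fin.last L)) b c := by
  rw [pathWeight, sum_Icc_succ_top (by omega), pathWeight]
  congr 1
  · refine sum_congr rfl fun i hi => ?_
    rw [mem_Icc] at hi
    rw [height_snoc (by omega), height_snoc (by omega), height_snoc (by omega)]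
  · rw [height_snoc (by omega), height_snoc (by omega), height, dif_pos (by omega), height,
      dif_neg (by omega), height, dif_neg (by omega)]
    push_cast
    rfl

theorem sum_filter_paths {p p' : ℕ} {a b c d : ℤ} {L : ℕ} (hb : 1 ≤ b) (hb' : b ≤ (p' : ℤ) - 1)
    (hd : b = d + 1 ∨ b = d - 1) :
    ∑ h ∈ (paths p' a b (L + 1)).filter (fun h => h (Fin.last L).castSucc = d),
      qpow (pathWeight p p' (L + 1) c h) =
      qpow ((L + 1) * localWeight p p' d b c) * phi p p' a d b L := by
  rw [phi, mul_sum]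
  refine sum_nbij' (fun h => (Fin.init h : Fin (L + 1) → ℤ))
    (fun g => (Fin.snoc g b : Fin (L + 2) → ℤ)) ?_ ?_ ?_ ?_ ?_
  · intro h hh
    rw [mem_filter] at hh
    rw [← hh.2]
    exact init_mem_paths hh.1
  · intro g hg
    rw [mem_filter]
    refine ⟨snoc_mem_paths hb hb' hd hg, ?_⟩
    simpa using (mem_paths.1 hg).2.2.1
  · intro h hh
    have hl := (mem_paths.1 (mem_filter.1 hh).1).2.2.1
    rw [← hl]
    exact Fin.snoc_init_self h
  · intro g _
    exact Fin.init_snoc (α := fun _ => ℤ) b g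
  · intro h hh
    rw [mem_filter] at hh
    have hl := (mem_paths.1 hh.1).2.2.1
    have hs : h = (Fin.snoc (Fin.init h : Fin (L + 1) → ℤ) b : Fin (L + 2) → ℤ) := by
      rw [← hl]
      exact (Fin.snoc_init_self h).symm
    nth_rewrite 1 [hs]
    rw [pathWeight_snoc, ← qpow_add, add_comm, show (Fin.init h : Fin (L + 1) → ℤ) (Fin.last L) = d
      from hh.2]

theorem phi_succ {p p' : ℕ} {a b c : ℤ} {L : ℕ} (hb : 1 ≤ b) (hb' : b ≤ (p' : ℤ) - 1) :
    phi p p' a b c (L + 1) =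
      qpow ((L + 1) * localWeight p p' (b - 1) b c) * phi p p' a (b - 1) b L +
      qpow ((L + 1) * localWeight p p' (b + 1) b c) * phi p p' a (b + 1) b L := by
  rw [← sum_filter_paths hb hb' (by omega), ← sum_filter_paths hb hb' (by omega), phi,
    ← sum_filter_add_sum_filter_not _ fun h : Fin (L + 2) → ℤ => h (Fin.last L).castSucc = b - 1]
  congr 2
  refine filter_congr fun h hh => ?_
  obtain ⟨-, -, h3, h4⟩ := mem_paths.1 hh
  have := h4 (Fin.last L)
  rw [Fin.succ_last, h3] at this
  omega

/-- The prefactor of `chi` is chosen so that, `rhat` growing by `0` or `1` per step, one coefficient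
is `1` and the other is a q-Pascal coefficient. -/
theorem chi_add_one_succ {p p' : ℕ} {a b : ℤ} {L : ℕ} (hb : 1 ≤ b) (hb' : b ≤ (p' : ℤ) - 1) :
    chi p p' a b (b + 1) (L + 1) =
      qpow ((1 - ((rhat p p' (b + 1) : ℚ) - rhat p p' b)) * ((L + 1 + a - b) / 2)) *
        chi p p' a (b - 1) b L +
      qpow (((rhat p p' (b + 1) : ℚ) - rhat p p' b) * ((L + 1 - a + b) / 2)) *
        chi p p' a (b + 1) b L := by
  simp only [chi]
  rw [phi_succ hb hb', mul_add, ← mul_assoc, ← mul_assoc, ← mul_assoc, ← mul_assoc, ← qpow_add,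
    ← qpow_add, ← qpow_add, ← qpow_add, localWeight, if_neg (by omega), localWeight, if_pos rfl,
    if_neg (by omega)]
  congr 3
  · push_cast; ring
  · push_cast; ring

theorem chi_sub_one_succ {p p' : ℕ} {a b : ℤ} {L : ℕ} (hb : 1 ≤ b) (hb' : b ≤ (p' : ℤ) - 1) :
    chi p p' a b (b - 1) (L + 1) =
      qpow (((rhat p p' b : ℚ) - rhat p p' (b - 1)) * ((L + 1 + a - b) / 2)) *
        chi p p' a (b - 1) b L +
      qpow ((1 - ((rhat p p' b : ℚ) - rhat p p' (b - 1))) * ((L + 1 - a + b) / 2)) *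
        chi p p' a (b + 1) b L := by
  simp only [chi]
  rw [phi_succ hb hb', mul_add, ← mul_assoc, ← mul_assoc, ← mul_assoc, ← mul_assoc, ← qpow_add,
    ← qpow_add, ← qpow_add, ← qpow_add, localWeight, if_pos rfl, if_pos (by omega), localWeight,
    if_neg (by omega)]
  congr 3
  · push_cast; ring
  · push_cast; ring

/-! ### Increments of `rhat`. -/

theorem rhat_spec {p p' : ℕ} (hp' : 0 < p') (h : ℤ) :
    rhat p p' h * p' ≤ h * (p' - p) ∧ h * ((p' : ℤ) - p) < (rhat p p' h + 1) * p' := by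
  have h0 : (0 : ℚ) < p' := by exact_mod_cast hp'
  constructor
  · have := Int.floor_le (((h : ℚ) * ((p' : ℚ) - p)) / p')
    rw [le_div_iff₀ h0] at this
    change (rhat p p' h : ℚ) * p' ≤ _ at this
    exact_mod_cast this
  · have := Int.lt_floor_add_one (((h : ℚ) * ((p' : ℚ) - p)) / p')
    rw [div_lt_iff₀ h0] at this
    change _ < ((rhat p p' h : ℚ) + 1) * p' at this
    exact_mod_cast this

theorem rhat_eq {p p' : ℕ} (hp' : 0 < p') {h k : ℤ} (h1 : k * p' ≤ h * (p' - p))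
    (h2 : h * ((p' : ℤ) - p) < (k + 1) * p') : rhat p p' h = k := by
  obtain ⟨h3, h4⟩ := rhat_spec (p := p) hp' h
  have h0 : (0 : ℤ) < p' := by exact_mod_cast hp'
  have := lt_of_mul_lt_mul_right (h3.trans_lt h2) h0.le
  have := lt_of_mul_lt_mul_right (h1.trans_lt h4) h0.le
  omega

theorem rhat_add_one {p p' : ℕ} (hp : 0 < p) (hpp' : p < p') (h : ℤ) :
    rhat p p' (h + 1) = rhat p p' h ∨ rhat p p' (h + 1) = rhat p p' h + 1 := by
  obtain ⟨h1, h2⟩ := rhat_spec (p := p) (p' := p') (by omega) h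
  obtain ⟨h3, h4⟩ := rhat_spec (p := p) (p' := p') (by omega) (h + 1)
  have h0 : (0 : ℤ) < p' := by omega
  have h5 : rhat p p' (h + 1) * p' < (rhat p p' h + 1 + 1) * p' := by
    have : (p : ℤ) > 0 := by omega
    linarith
  have h6 : rhat p p' h * p' < (rhat p p' (h + 1) + 1) * p' := by
    have : (p : ℤ) < p' := by omega
    linarith
  have := lt_of_mul_lt_mul_right h5 h0.le
  have := lt_of_mul_lt_mul_right h6 h0.le
  omega

/-! ### Bosonic form of the path generating functions. -/

/-- The summand of `bpoly`. -/
def bterm (p p' a L u r l : ℤ) : QPoly :=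
  qpow ((p : ℚ) * p' * l ^ 2 + l * (p' * r - p * a)) * gauss L (u - p' * l) -
    qpow (((p : ℚ) * l + r) * (p' * l + a)) * gauss L (u - p' * l - a)

/-- The bosonic form of the path generating functions. -/
def bpoly (p p' a L u r : ℤ) : QPoly := ∑ᶠ l : ℤ, bterm p p' a L u r l

theorem finite_support_gauss {p' : ℤ} (hp' : 0 < p') (f : ℤ → QPoly) (L u : ℤ) :
    (fun l => f l * gauss L (u - p' * l)).support.Finite := by
  refine finite_support_of_abs (|u| + |L|) fun l hl => ?_
  rw [gauss_eq_zero, mul_zero]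
  have h1 := abs_nonneg u
  have h2 := abs_nonneg L
  have h3 := le_abs_self L
  have h4 := le_abs_self u
  have h5 := neg_abs_le u
  rcases lt_abs.1 hl with h | h
  · left
    nlinarith
  · right
    nlinarith

theorem finite_support_bterm {p' : ℤ} (hp' : 0 < p') (p a L u r : ℤ) :
    (bterm p p' a L u r).support.Finite := by
  refine ((finite_support_gauss hp' (fun l => qpow ((p : ℚ) * p' * l ^ 2 + l * (p' * r - p * a)))
    L u).union (finite_support_gauss hp' (fun l => qpow (((p : ℚ) * l + r) * (p' * l + a)))
    L (u - a))).subset ?_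
  intro l hl
  by_contra hcon
  rw [Set.mem_union, not_or, Function.notMem_support, Function.notMem_support] at hcon
  refine hl ?_
  rw [bterm, hcon.1, show u - p' * l - a = u - a - p' * l by ring, hcon.2, sub_zero]

/-- Pascal's rule termwise: the part of its exponent that depends on `l` is exactly what replacing
`r` by `r + 1` contributes. -/
theorem bpoly_pascal {p' L : ℤ} (hp' : 0 < p') (hL : 0 ≤ L) (p a u r : ℤ) :
    bpoly p p' a (L + 1) u r =
      bpoly p p' a L u r + qpow (L + 1 - u) * bpoly p p' a L (u - 1) (r + 1) := by
  rw [bpoly, bpoly, bpoly, mul_finsum, ← finsum_add_distrib (finite_support_bterm hp' _ _ _ _ _)]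
  · refine finsum_congr fun l => ?_
    rw [bterm, bterm, bterm, gauss_pascal hL, gauss_pascal hL,
      show u - p' * l - 1 = u - 1 - p' * l by ring,
      show u - p' * l - a - 1 = u - 1 - p' * l - a by ring]
    have q1 : qpow ((p : ℚ) * p' * l ^ 2 + l * (p' * r - p * a)) *
        qpow ((L : ℚ) + 1 - (u - p' * l : ℤ)) =
        qpow (L + 1 - u) * qpow ((p : ℚ) * p' * l ^ 2 + l * (p' * (r + 1 : ℤ) - p * a)) := by
      rw [← qpow_add, ← qpow_add]
      congr 1
      push_cast
      ring
    have q2 : qpow (((p : ℚ) * l + r) * (p' * l + a)) *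
        qpow ((L : ℚ) + 1 - (u - p' * l - a : ℤ)) =
        qpow (L + 1 - u) * qpow (((p : ℚ) * l + (r + 1 : ℤ)) * (p' * l + a)) := by
      rw [← qpow_add, ← qpow_add]
      congr 1
      push_cast
      ring
    linear_combination gauss L (u - 1 - p' * l) * q1 - gauss L (u - 1 - p' * l - a) * q2
  · exact (finite_support_bterm hp' p a L (u - 1) (r + 1)).subset fun l hl h => hl (by simp [h])

theorem bpoly_pascal' {p' L : ℤ} (hp' : 0 < p') (hL : 0 ≤ L) (p a u r : ℤ) :
    bpoly p p' a (L + 1) u r =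
      qpow u * bpoly p p' a L u (r - 1) + bpoly p p' a L (u - 1) r := by
  rw [bpoly, bpoly, bpoly, mul_finsum, ← finsum_add_distrib _ (finite_support_bterm hp' _ _ _ _ _)]
  · refine finsum_congr fun l => ?_
    rw [bterm, bterm, bterm, gauss_pascal' hL, gauss_pascal' hL,
      show u - p' * l - 1 = u - 1 - p' * l by ring,
      show u - p' * l - a - 1 = u - 1 - p' * l - a by ring]
    have q1 : qpow ((p : ℚ) * p' * l ^ 2 + l * (p' * r - p * a)) *
        qpow (u - p' * l : ℤ) =
        qpow u * qpow ((p : ℚ) * p' * l ^ 2 + l * (p' * (r - 1 : ℤ) - p * a)) := by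
      rw [← qpow_add, ← qpow_add]
      congr 1
      push_cast
      ring
    have q2 : qpow (((p : ℚ) * l + r) * (p' * l + a)) *
        qpow (u - p' * l - a : ℤ) =
        qpow u * qpow (((p : ℚ) * l + (r - 1 : ℤ)) * (p' * l + a)) := by
      rw [← qpow_add, ← qpow_add]
      congr 1
      push_cast
      ring
    linear_combination gauss L (u - p' * l) * q1 - gauss L (u - p' * l - a) * q2
  · exact (finite_support_bterm hp' p a L u (r - 1)).subset fun l hl h => hl (by simp [h])

/-- The lower wall `b = 0`: by Gaussian symmetry the second family is the first one under `l ↦ -l`.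
-/
theorem bpoly_bot {p' : ℤ} (hp' : 0 < p') {p a L u : ℤ} (hu : 2 * u = L + a) :
    bpoly p p' a L u 0 = 0 := by
  rw [← finsum_sub_comp_equiv (finite_support_gauss hp'
    (fun l => qpow ((p : ℚ) * p' * l ^ 2 + l * (p' * (0 : ℤ) - p * a))) L u) (Equiv.neg ℤ)]
  refine finsum_congr fun l => ?_
  rw [bterm, Equiv.neg_apply, ← gauss_symm L (u - p' * -l)]
  congr 3
  · push_cast; ring
  · linarith

/-- The upper wall `b = p'`, with the reflection `l ↦ -1 - l`. -/
theorem bpoly_top {p' : ℤ} (hp' : 0 < p') {p a L u : ℤ} (hu : 2 * u = L + a - p') :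
    bpoly p p' a L u p = 0 := by
  rw [← finsum_sub_comp_equiv (finite_support_gauss hp'
    (fun l => qpow ((p : ℚ) * p' * l ^ 2 + l * (p' * p - p * a))) L u) (Equiv.subLeft (-1))]
  refine finsum_congr fun l => ?_
  rw [bterm, Equiv.subLeft_apply, ← gauss_symm L (u - p' * (-1 - l))]
  congr 3
  · push_cast; ring
  · linarith

theorem bpoly_zero {p' a b u : ℤ} (ha : 1 ≤ a) (ha' : a ≤ p' - 1) (hb : 0 ≤ b) (hb' : b ≤ p')
    (hu : 2 * u = 0 + a - b) (p r : ℤ) : bpoly p p' a 0 u r = if a = b then 1 else 0 := by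
  have hz : ∀ l : ℤ, l ≠ 0 → bterm p p' a 0 u r l = 0 := by
    intro l hl
    rw [bterm, gauss_eq_zero, gauss_eq_zero]
    · ring
    · rcases lt_or_gt_of_ne hl with h | h
      · right; nlinarith
      · left; nlinarith
    · rcases lt_or_gt_of_ne hl with h | h
      · right; nlinarith
      · left; nlinarith
  rw [bpoly, finsum_eq_single _ 0 hz, bterm, gauss_eq_zero (A := 0) (B := u - p' * 0 - a) (by omega)]
  split_ifs with h
  · obtain rfl : u = 0 := by omega
    simp [qpow_zero, gauss_zero_right]
  · rw [gauss_eq_zero (by omega)]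
    ring

/-- Induction on `L`. In both cases the last argument is `(b + c - 1)/2 - rhat c`. The walls `b = 0`
(with `c = 1`) and `b = p'` (with `c = p' - 1`) are included, so that the recurrence can be applied
at every interior `b`; there `chi` vanishes for lack of paths. -/
theorem chi_eq_bpoly {p p' : ℕ} (hp : 0 < p) (hpp' : p < p') {a : ℤ} (ha : 1 ≤ a)
    (ha' : a ≤ (p' : ℤ) - 1) (L : ℕ) : ∀ b u : ℤ, 2 * u = L + a - b →
      (0 ≤ b → b ≤ (p' : ℤ) - 1 →
        chi p p' a b (b + 1) L = bpoly p p' a L u (b - rhat p p' (b + 1))) ∧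
      (1 ≤ b → b ≤ p' →
        chi p p' a b (b - 1) L = bpoly p p' a L u (b - 1 - rhat p p' (b - 1))) := by
  have hp'0 : 0 < p' := by omega
  have hpos : (0 : ℤ) < p' := by omega
  have r1 : rhat p p' 1 = 0 := rhat_eq hp'0 (by omega) (by omega)
  have r2 : rhat p p' ((p' : ℤ) - 1) = p' - p - 1 := rhat_eq hp'0 (by nlinarith) (by nlinarith)
  induction L with
  | zero =>
    intro b u hu
    constructor
    · intro hb hb'
      rw [chi, phi_zero _ _ _ _ _ ha ha']
      simp only [Nat.cast_zero, mul_zero]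
      rw [bpoly_zero ha ha' hb (by omega) (by simpa using hu)]
      split_ifs with h
      · subst h
        simp [qpow_zero]
      · rw [mul_zero]
    · intro hb hb'
      rw [chi, phi_zero _ _ _ _ _ ha ha']
      simp only [Nat.cast_zero, mul_zero]
      rw [bpoly_zero ha ha' (by omega) hb' (by simpa using hu)]
      split_ifs with h
      · subst h
        simp [qpow_zero]
      · rw [mul_zero]
  | succ L ih =>
    intro b u hu
    push_cast at hu
    have hu1 : ((L : ℚ) + 1 + a - b) / 2 = u := by
      have : ((2 * u : ℤ) : ℚ) = (L + 1 + a - b : ℤ) := by rw [hu]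
      push_cast at this
      linarith
    have hu2 : ((L : ℚ) + 1 - a + b) / 2 = (L : ℤ) + 1 - u := by
      rw [← hu1]
      push_cast
      ring
    have ih1 := ih (b - 1) u (by omega)
    have ih2 := ih (b + 1) (u - 1) (by omega)
    rw [sub_add_cancel] at ih1
    rw [add_sub_cancel_right] at ih2
    push_cast
    constructor
    · intro hb hb'
      rcases eq_or_lt_of_le hb with rfl | hb
      · rw [chi, phi_eq_zero (by omega), zero_add, r1, sub_zero, bpoly_bot hpos (by omega),
          mul_zero]
      · rw [chi_add_one_succ (by omega) hb', ih1.1 (by omega) (by omega),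
          ih2.2 (by omega) (by omega), hu1, hu2]
        -- The increment of `rhat` decides which of the two Pascal rules matches the recurrence.
        rcases rhat_add_one hp hpp' b with h | h <;> rw [h]
        · rw [bpoly_pascal' hpos (by omega)]
          simp [qpow_zero, sub_right_comm]
        · rw [bpoly_pascal hpos (by omega)]
          push_cast
          rw [add_sub_cancel_left, sub_self, zero_mul, qpow_zero, one_mul, one_mul]
          rw [show b - (rhat p p' b + 1) + 1 = b - rhat p p' b by ring,
            show b - (rhat p p' b + 1) = b - 1 - rhat p p' b by ring]
    · intro hb hb'
      rcases eq_or_lt_of_le hb' with rfl | hb'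
      · rw [chi, phi_eq_zero (by omega), r2, show (p' : ℤ) - 1 - (p' - p - 1) = p by ring,
          bpoly_top hpos (by omega), mul_zero]
      · rw [chi_sub_one_succ hb (by omega), ih1.1 (by omega) (by omega),
          ih2.2 (by omega) (by omega), hu1, hu2]
        have hr := rhat_add_one hp hpp' (b - 1)
        rw [sub_add_cancel] at hr
        rcases hr with h | h <;> rw [h]
        · rw [bpoly_pascal hpos (by omega)]
          simp only [sub_self, zero_mul, qpow_zero, one_mul, sub_zero]
          congr 3
          ring
        · rw [bpoly_pascal' hpos (by omega)]
          push_cast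
          rw [add_sub_cancel_left, sub_self, zero_mul, qpow_zero, one_mul, one_mul]
          rw [show b - 1 - rhat p p' (b - 1) - 1 = b - 1 - (rhat p p' (b - 1) + 1) by ring,
            show b - 1 - rhat p p' (b - 1) = b - (rhat p p' (b - 1) + 1) by ring]

/-- The bosonic form of the generating functions for the least pair. -/
theorem chi_eq_ypoly {p p' : ℕ} (hp : 0 < p) (hpp' : p < p') {r s : ℕ} (hs : 1 ≤ s)
    (hsp : s + 1 ≤ p') (hrp : 2 * r ≤ p) (h : |(p : ℤ) * s - p' * r| = 1) (N : ℕ) :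
    chi p p' s s (s + 1) (2 * N) = ypoly p p' r s N := by
  have hpos : (0 : ℤ) < p' := by omega
  -- From `p s - p' r = ±1`, `(s + 1)(p' - p) = (s - r) p' + (p' - p ∓ 1)`. The remainder lies in
  -- `[0, p')`; with the lower sign this needs `p ≥ 2`.
  have hr : rhat p p' ((s : ℤ) + 1) = s - r := by
    rcases (abs_eq zero_le_one).1 h with h | h
    · exact rhat_eq (by omega) (by nlinarith) (by nlinarith)
    · have : 2 ≤ p := by
        by_contra hcon
        obtain rfl : r = 0 := by omega
        have : (0 : ℤ) ≤ p * s := by positivity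
        simp only [Nat.cast_zero, mul_zero, sub_zero] at h
        omega
      exact rhat_eq (by omega) (by nlinarith) (by nlinarith)
  rw [((chi_eq_bpoly hp hpp' (a := s) (by omega) (by omega) (2 * N)) s N (by push_cast; ring)).1
    (by omega) (by omega), hr, show (s : ℤ) - (s - r) = r by ring, bpoly, ypoly]
  push_cast
  set f : ℤ → QPoly := fun l =>
    qpow ((p : ℚ) * p' * l ^ 2 + l * (p' * r - p * s)) * gauss (2 * N) (N - p' * l) with hf
  have hf' : f.support.Finite := finite_support_gauss hpos _ _ _
  have hg : (fun l : ℤ => qpow (((p : ℚ) * l + r) * (p' * l + s)) *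
      gauss (2 * N) (N - s - p' * l)).support.Finite := finite_support_gauss hpos _ _ _
  have hb : ∀ l, bterm p p' s (2 * N) N r l = f l - qpow (((p : ℚ) * l + r) * (p' * l + s)) *
      gauss (2 * N) (N - s - p' * l) := by
    intro l
    rw [bterm, sub_right_comm (N : ℤ) s]
    push_cast
    rfl
  rw [finsum_congr hb, finsum_sub_distrib hf' hg]
  rcases (abs_eq zero_le_one).1 h with h | h
  -- For determinant `+1` the linear exponent is `-l`, so the first family is reindexed by `l ↦ -l`.
  · rw [← finsum_comp_equiv (Equiv.neg ℤ), ← finsum_sub_distrib _ hg]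
    · refine finsum_congr fun l => ?_
      have hq : (p : ℚ) * s - p' * r = 1 := by exact_mod_cast h
      rw [yterm, Equiv.neg_apply, ← gauss_symm _ (N - p' * l)]
      simp only [hf]
      congr 3
      · push_cast
        linear_combination (l : ℚ) * hq
      · ring
      · push_cast; ring
      · ring
    · exact hf'.preimage (Equiv.neg ℤ).injective.injOn
  · rw [← finsum_sub_distrib hf' hg]
    refine finsum_congr fun l => ?_
    have hq : (p : ℚ) * s - p' * r = -1 := by exact_mod_cast h
    rw [yterm]
    simp only [hf]
    congr 3
    · push_cast
      linear_combination -(l : ℚ) * hq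
    · push_cast; ring
    · ring

/-! ### The partition sum with two free bounds. -/

theorem sum_Icc_one {A : Type*} [AddCommMonoid A] (f : ℕ → A) (m : ℕ) :
    ∑ i ∈ Icc 1 m, f i = ∑ i ∈ range m, f (i + 1) := by
  rw [range_eq_Ico, sum_Ico_add']
  rfl

theorem prod_Icc_one_add {A : Type*} [CommMonoid A] (f : ℕ → A) (d m : ℕ) :
    ∏ i ∈ Icc (1 + d) m, f i = ∏ i ∈ Ico d m, f (i + 1) := by
  rw [prod_Ico_add', add_comm]
  rfl

theorem wt_eq_sum_range (e : ℕ → ℕ) (lam : ℕ → ℕ → ℕ) (μ : ℕ) :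
    wt e lam μ = ∑ i ∈ range (e μ), lam μ (i + 1) :=
  sum_Icc_one _ _

/-- The sequence `l` with its value at `0` replaced by `P`. -/
def ext (P : ℤ) (l : ℕ → ℕ) (i : ℕ) : ℤ := if i = 0 then P else l i

theorem ext_zero (P : ℤ) (l : ℕ → ℕ) : ext P l 0 = P := rfl

theorem ext_succ (P : ℤ) (l : ℕ → ℕ) (i : ℕ) : ext P l (i + 1) = l (i + 1) := rfl

/-- The pairs `(w_μ, λ^{(μ)}_0)` obtained from arbitrary initial values. -/
def bounds (e : ℕ → ℕ) (lam : ℕ → ℕ → ℕ) (N M : ℤ) : ℕ → ℤ × ℤ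
  | 0 => (N, M)
  | μ + 1 => (ext (bounds e lam N M μ).2 (lam μ) (e μ), (bounds e lam N M μ).1 - wt e lam μ)

/-- The conditions on the sequences of partitions, with arbitrary initial values. -/
structure IsBounded (n : ℕ) (e : ℕ → ℕ) (N M : ℤ) (lam : ℕ → ℕ → ℕ) : Prop where
  eq_zero : ∀ μ i, ¬ (μ ≤ n ∧ 1 ≤ i ∧ i ≤ e μ) → lam μ i = 0
  le_ext : ∀ μ, μ ≤ n → ∀ i < e μ, (lam μ (i + 1) : ℤ) ≤ ext (bounds e lam N M μ).2 (lam μ) i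
  wt_le : ∀ μ, μ ≤ n → (wt e lam μ : ℤ) ≤ (bounds e lam N M μ).1
  wt_eq : (wt e lam n : ℤ) = (bounds e lam N M n).1

/-- The Gaussian factor belonging to the part `l (i + 1)`. -/
def gfactor (W P : ℤ) (l : ℕ → ℕ) (i : ℕ) : QPoly :=
  gauss (2 * (W - ∑ j ∈ range (i + 1), (l (j + 1) : ℤ)) + ext P l i + l (i + 1))
    (ext P l i - l (i + 1))

/-- The fermionic summand, where the first `d` factors of the first partition are left out. -/
def fterm (d n : ℕ) (e : ℕ → ℕ) (N M : ℤ) (lam : ℕ → ℕ → ℕ) : QPoly :=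
  qpow (∑ i ∈ range (e 0), (lam 0 (i + 1) : ℚ) ^ 2) *
    qpow (∑ μ ∈ range n, ∑ i ∈ range (e (μ + 1)), (lam (μ + 1) (i + 1) : ℚ) ^ 2) *
    ((∏ i ∈ Ico d (e 0), gfactor N M (lam 0) i) *
      ∏ μ ∈ range n, ∏ i ∈ range (e (μ + 1)), gfactor (bounds e lam N M (μ + 1)).1
        (bounds e lam N M (μ + 1)).2 (lam (μ + 1)) i)

/-! ### Removing the first part of the first partition -/

/-- Put a part `k` in front of the first partition. -/
def consPart (k : ℕ) (l : ℕ → ℕ → ℕ) : ℕ → ℕ → ℕ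
  | 0, 0 => 0
  | 0, 1 => k
  | 0, i + 2 => l 0 (i + 1)
  | μ + 1, i => l (μ + 1) i

/-- Remove the first part of the first partition. -/
def tailPart (l : ℕ → ℕ → ℕ) : ℕ → ℕ → ℕ
  | 0, 0 => 0
  | 0, i + 1 => l 0 (i + 2)
  | μ + 1, i => l (μ + 1) i

theorem tailPart_consPart {k : ℕ} {l : ℕ → ℕ → ℕ} (h : l 0 0 = 0) :
    tailPart (consPart k l) = l := by
  funext μ i
  match μ, i with
  | 0, 0 => exact h.symm
  | 0, i + 1 => rfl
  | μ + 1, i => rfl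

theorem consPart_tailPart {l : ℕ → ℕ → ℕ} (h : l 0 0 = 0) :
    consPart (l 0 1) (tailPart l) = l := by
  funext μ i
  match μ, i with
  | 0, 0 => exact h.symm
  | 0, 1 => rfl
  | 0, i + 2 => rfl
  | μ + 1, i => rfl

section Peel

variable {e e' : ℕ → ℕ}

theorem ext_consPart (M : ℤ) (k : ℕ) (l : ℕ → ℕ → ℕ) (i : ℕ) :
    ext M (consPart k l 0) (i + 1) = ext k (l 0) i := by
  cases i <;> rfl

theorem wt_consPart_succ (h1 : ∀ μ, e (μ + 1) = e' (μ + 1)) (k : ℕ) (l : ℕ → ℕ → ℕ) (μ : ℕ) :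
    wt e (consPart k l) (μ + 1) = wt e' l (μ + 1) := by
  rw [wt, h1]
  rfl

theorem wt_consPart_zero (h0 : e 0 = e' 0 + 1) (k : ℕ) (l : ℕ → ℕ → ℕ) :
    wt e (consPart k l) 0 = wt e' l 0 + k := by
  rw [wt_eq_sum_range, wt_eq_sum_range, h0, sum_range_succ']
  rfl

/-- Splitting off a first part `k` turns the initial bounds `(N, M)` into `(N - k, k)`, exactly the
arguments in Burge's transform. -/
theorem bounds_consPart (h0 : e 0 = e' 0 + 1) (h1 : ∀ μ, e (μ + 1) = e' (μ + 1)) (N M : ℤ)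
    (k : ℕ) (l : ℕ → ℕ → ℕ) (μ : ℕ) :
    bounds e (consPart k l) N M (μ + 1) = bounds e' l (N - k) k (μ + 1) := by
  induction μ with
  | zero =>
    simp only [bounds]
    rw [h0, ext_consPart, wt_consPart_zero h0]
    congr 1
    push_cast
    ring
  | succ μ ih =>
    rw [bounds, ih, wt_consPart_succ h1, h1]
    rfl

theorem isBounded_consPart (h0 : e 0 = e' 0 + 1) (h1 : ∀ μ, e (μ + 1) = e' (μ + 1)) {n : ℕ}
    {N M : ℤ} {k : ℕ} {l : ℕ → ℕ → ℕ} (hl : l 0 0 = 0) :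
    IsBounded n e N M (consPart k l) ↔ (k : ℤ) ≤ M ∧ IsBounded n e' (N - k) k l := by
  have hb := bounds_consPart h0 h1 N M k l
  constructor
  · intro h
    refine ⟨?_, ?_, ?_, ?_, ?_⟩
    · have := h.le_ext 0 (Nat.zero_le n) 0 (by omega)
      exact this
    · intro μ i hi
      match μ, i with
      | 0, 0 => exact hl
      | 0, i + 1 => exact h.eq_zero 0 (i + 2) (by omega)
      | μ + 1, i => exact h.eq_zero (μ + 1) i (by rwa [h1])
    · intro μ hμ i hi
      match μ with
      | 0 =>
        have := h.le_ext 0 hμ (i + 1) (by omega)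
        rwa [ext_consPart] at this
      | μ + 1 =>
        have := h.le_ext (μ + 1) hμ i (by rwa [h1])
        rwa [hb] at this
    · intro μ hμ
      match μ with
      | 0 =>
        have := h.wt_le 0 hμ
        rw [wt_consPart_zero h0] at this
        simp only [bounds] at this ⊢
        push_cast at this
        linarith
      | μ + 1 =>
        have := h.wt_le (μ + 1) hμ
        rwa [hb, wt_consPart_succ h1] at this
    · match n with
      | 0 =>
        have := h.wt_eq
        rw [wt_consPart_zero h0] at this
        simp only [bounds] at this ⊢
        push_cast at this
        linarith
      | n + 1 =>
        have := h.wt_eq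
        rwa [hb, wt_consPart_succ h1] at this
  · rintro ⟨hk, h⟩
    refine ⟨?_, ?_, ?_, ?_⟩
    · intro μ i hi
      match μ, i with
      | 0, 0 => rfl
      | 0, 1 => omega
      | 0, i + 2 => exact h.eq_zero 0 (i + 1) (by omega)
      | μ + 1, i => exact h.eq_zero (μ + 1) i (by rwa [← h1])
    · intro μ hμ i hi
      match μ, i with
      | 0, 0 => exact hk
      | 0, i + 1 =>
        rw [ext_consPart]
        exact h.le_ext 0 hμ i (by omega)
      | μ + 1, i =>
        rw [hb]
        exact h.le_ext (μ + 1) hμ i (by rwa [← h1])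
    · intro μ hμ
      match μ with
      | 0 =>
        have := h.wt_le 0 hμ
        rw [wt_consPart_zero h0]
        simp only [bounds] at this ⊢
        push_cast
        linarith
      | μ + 1 =>
        have := h.wt_le (μ + 1) hμ
        rwa [hb, wt_consPart_succ h1]
    · match n with
      | 0 =>
        have := h.wt_eq
        rw [wt_consPart_zero h0]
        simp only [bounds] at this ⊢
        push_cast
        linarith
      | n + 1 =>
        have := h.wt_eq
        rwa [hb, wt_consPart_succ h1]

theorem gfactor_consPart (N M : ℤ) (k : ℕ) (l : ℕ → ℕ → ℕ) (i : ℕ) :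
    gfactor N M (consPart k l 0) (i + 1) = gfactor (N - k) k (l 0) i := by
  rw [gfactor, gfactor, ext_consPart, sum_range_succ']
  change gauss (2 * (N - (∑ j ∈ range (i + 1), (l 0 (j + 1) : ℤ) + k)) + _ + (l 0 (i + 1) : ℤ))
    (_ - (l 0 (i + 1) : ℤ)) = _
  congr 3
  ring

theorem fterm_one_consPart (h0 : e 0 = e' 0 + 1) (h1 : ∀ μ, e (μ + 1) = e' (μ + 1)) (n : ℕ)
    (N M : ℤ) (k : ℕ) (l : ℕ → ℕ → ℕ) :
    fterm 1 n e N M (consPart k l) = qpow ((k : ℚ) ^ 2) * fterm 0 n e' (N - k) k l := by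
  rw [fterm, fterm, h0, sum_range_succ', qpow_add, ← Finset.prod_Ico_add' _ 0 (e' 0) 1]
  simp only [bounds_consPart h0 h1, h1, gfactor_consPart]
  change qpow (∑ i ∈ range (e' 0), (l 0 (i + 1) : ℚ) ^ 2) * qpow ((k : ℚ) ^ 2) *
    qpow (∑ μ ∈ range n, ∑ i ∈ range (e' (μ + 1)), (l (μ + 1) (i + 1) : ℚ) ^ 2) *
    (_ * ∏ μ ∈ range n, ∏ i ∈ range (e' (μ + 1)), gfactor (bounds e' l (N - k) k (μ + 1)).1
        (bounds e' l (N - k) k (μ + 1)).2 (l (μ + 1)) i) = _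
  ring

/-- Isolates the Gaussian factor of the first part, the kernel of the doubly bounded Burge
transform; `fterm 1` omits it, as in the limiting transform. -/
theorem fterm_zero_eq (h0 : 0 < e 0) (n : ℕ) (N M : ℤ) (l : ℕ → ℕ → ℕ) :
    fterm 0 n e N M l =
      gauss (2 * N + M - l 0 1) (M - l 0 1) * fterm 1 n e N M l := by
  rw [fterm, fterm, prod_eq_prod_Ico_succ_bot h0,
    show gfactor N M (l 0) 0 = gauss (2 * N + M - l 0 1) (M - l 0 1) by
      rw [gfactor, ext_zero, zero_add, sum_range_one]
      congr 1
      ring]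
  ring

end Peel

/-- Summing over the first part of the first partition. -/
theorem sum_isBounded_cons {e e' : ℕ → ℕ} (h0 : e 0 = e' 0 + 1)
    (h1 : ∀ μ, e (μ + 1) = e' (μ + 1)) {n N M : ℕ} {S : Finset (ℕ → ℕ → ℕ)}
    (hS : ∀ lam, lam ∈ S ↔ IsBounded n e N M lam) {f : (ℕ → ℕ → ℕ) → QPoly}
    {c : ℕ → QPoly} {g : ℕ → (ℕ → ℕ → ℕ) → QPoly}
    (hf : ∀ k l, f (consPart k l) = c k * g k l) (hc : ∀ k, M < k → k ≤ N → c k = 0)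
    {F : ℕ → QPoly}
    (hF : ∀ k, k ≤ N → ∀ T : Finset (ℕ → ℕ → ℕ),
      (∀ l, l ∈ T ↔ IsBounded n e' (N - k : ℕ) k l) → ∑ l ∈ T, g k l = F k) :
    ∑ lam ∈ S, f lam = ∑ k ∈ range (N + 1), c k * F k := by
  classical
  have hz : ∀ lam ∈ S, lam 0 0 = 0 := fun lam hlam =>
    ((hS lam).1 hlam).eq_zero 0 0 (by omega)
  have hmaps : ∀ lam ∈ S, lam 0 1 ∈ range (N + 1) := by
    intro lam hlam
    have hw := ((hS lam).1 hlam).wt_le 0 (Nat.zero_le n)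
    rw [← consPart_tailPart (hz lam hlam), wt_consPart_zero h0] at hw
    simp only [bounds] at hw
    rw [mem_range]
    omega
  -- Fibre over the first part `k`. The bound `k ≤ M` is not in the final range of summation; `hc`
  -- makes the surplus terms vanish.
  rw [← sum_fiberwise_of_maps_to hmaps]
  refine sum_congr rfl fun k hk => ?_
  have hkN : k ≤ N := by
    rw [mem_range] at hk
    omega
  by_cases hkM : k ≤ M
  · rw [← hF k hkN ((S.filter fun lam => lam 0 1 = k).image tailPart), sum_image, mul_sum]
    · refine sum_congr rfl fun lam hlam => ?_
      rw [mem_filter] at hlam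
      rw [← hf, ← hlam.2, consPart_tailPart (hz lam hlam.1)]
    · intro x hx y hy hxy
      rw [mem_coe, mem_filter] at hx hy
      rw [← consPart_tailPart (hz x hx.1), ← consPart_tailPart (hz y hy.1), hx.2, hy.2, hxy]
    · intro l
      rw [mem_image, Nat.cast_sub hkN]
      constructor
      · rintro ⟨lam, hlam, rfl⟩
        rw [mem_filter] at hlam
        have hb := (hS lam).1 hlam.1
        rw [← consPart_tailPart (hz lam hlam.1), hlam.2, isBounded_consPart h0 h1 rfl] at hb
        exact hb.2
      · intro hl
        have hl0 : l 0 0 = 0 := hl.eq_zero 0 0 (by omega)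
        refine ⟨consPart k l, mem_filter.2 ⟨(hS _).2 ?_, rfl⟩, tailPart_consPart hl0⟩
        exact (isBounded_consPart h0 h1 hl0).2 ⟨by exact_mod_cast hkM, hl⟩
  · rw [hc k (by omega) hkN, zero_mul]
    refine sum_eq_zero fun lam hlam => ?_
    rw [mem_filter] at hlam
    have := ((hS lam).1 hlam.1).le_ext 0 (Nat.zero_le n) 0 (by omega)
    rw [ext_zero, zero_add, hlam.2] at this
    simp only [bounds] at this
    omega

/-! ### Removing an empty first partition -/

/-- Put an empty partition in front of a sequence of partitions. -/
def consRow (l : ℕ → ℕ → ℕ) : ℕ → ℕ → ℕ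
  | 0 => fun _ => 0
  | μ + 1 => l μ

theorem wt_zero {e : ℕ → ℕ} (h0 : e 0 = 0) (lam : ℕ → ℕ → ℕ) : wt e lam 0 = 0 := by
  rw [wt, h0]
  rfl

/-- An empty `λ⁽⁰⁾` passes on `w_1 = λ⁽⁰⁾_0 = M` and `λ⁽¹⁾_0 = N`: the bounds are exchanged. This is
why `bounds` reads its parts through `ext`. -/
theorem bounds_consRow {e : ℕ → ℕ} (h0 : e 0 = 0) (N M : ℤ) (l : ℕ → ℕ → ℕ) (μ : ℕ) :
    bounds e (consRow l) N M (μ + 1) = bounds (fun μ => e (μ + 1)) l M N μ := by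
  induction μ with
  | zero =>
    simp only [bounds, h0, ext_zero, wt_zero h0]
    simp
  | succ μ ih =>
    rw [bounds, ih]
    rfl

theorem isBounded_consRow {e : ℕ → ℕ} (h0 : e 0 = 0) {n : ℕ} {N M : ℤ} (hN : 0 ≤ N)
    {l : ℕ → ℕ → ℕ} :
    IsBounded (n + 1) e N M (consRow l) ↔ IsBounded n (fun μ => e (μ + 1)) M N l := by
  have hb := bounds_consRow h0 N M l
  constructor
  · intro h
    refine ⟨fun μ i hi => h.eq_zero (μ + 1) i (by omega), fun μ hμ i hi => ?_, fun μ hμ => ?_, ?_⟩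
    · have := h.le_ext (μ + 1) (by omega) i hi
      rwa [hb] at this
    · have := h.wt_le (μ + 1) (by omega)
      rwa [hb] at this
    · have := h.wt_eq
      rwa [hb] at this
  · intro h
    refine ⟨fun μ i hi => ?_, fun μ hμ i hi => ?_, fun μ hμ => ?_, ?_⟩
    · match μ with
      | 0 => rfl
      | μ + 1 => exact h.eq_zero μ i (by omega)
    · match μ with
      | 0 => omega
      | μ + 1 =>
        rw [hb]
        exact h.le_ext μ (by omega) i hi
    · match μ with
      | 0 =>
        rw [wt_zero h0]
        exact hN
      | μ + 1 =>
        rw [hb]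
        exact h.wt_le μ (by omega)
    · rw [hb]
      exact h.wt_eq

theorem fterm_consRow {e : ℕ → ℕ} (h0 : e 0 = 0) (n : ℕ) (N M : ℤ) (l : ℕ → ℕ → ℕ) :
    fterm 0 (n + 1) e N M (consRow l) = fterm 0 n (fun μ => e (μ + 1)) M N l := by
  rw [fterm, fterm, h0, sum_range_succ', prod_range_succ']
  simp only [bounds_consRow h0, range_zero, sum_empty, qpow_zero, Ico_self, prod_empty, one_mul,
    Nat.Ico_zero_eq_range]
  rw [add_comm, qpow_add, mul_comm (∏ k ∈ range n, _)]
  rfl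

theorem sum_isBounded_consRow {e : ℕ → ℕ} (h0 : e 0 = 0) {n N M : ℕ}
    {S : Finset (ℕ → ℕ → ℕ)} (hS : ∀ lam, lam ∈ S ↔ IsBounded (n + 1) e N M lam) {X : QPoly}
    (hX : ∀ T : Finset (ℕ → ℕ → ℕ),
      (∀ l, l ∈ T ↔ IsBounded n (fun μ => e (μ + 1)) M N l) →
      ∑ l ∈ T, fterm 0 n (fun μ => e (μ + 1)) M N l = X) :
    ∑ lam ∈ S, fterm 0 (n + 1) e N M lam = X := by
  classical
  have hz : ∀ lam ∈ S, consRow (fun μ => lam (μ + 1)) = lam := by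
    intro lam hlam
    funext μ i
    match μ with
    | 0 => exact (((hS lam).1 hlam).eq_zero 0 i (by omega)).symm
    | μ + 1 => rfl
  rw [← hX (S.image fun lam μ => lam (μ + 1)), sum_image]
  · refine sum_congr rfl fun lam hlam => ?_
    rw [← fterm_consRow h0, hz lam hlam]
  · intro x hx y hy hxy
    rw [← hz x hx, ← hz y hy]
    exact congrArg consRow hxy
  · intro l
    rw [mem_image, ← isBounded_consRow h0 (by positivity), ← hS]
    constructor
    · rintro ⟨lam, hlam, rfl⟩
      rwa [hz lam hlam]
    · intro hl
      exact ⟨_, hl, rfl⟩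

theorem isBounded_zero {e : ℕ → ℕ} (h0 : e 0 = 0) {N M : ℤ} {lam : ℕ → ℕ → ℕ} :
    IsBounded 0 e N M lam ↔ lam = 0 ∧ N = 0 := by
  constructor
  · intro h
    have hw := h.wt_eq
    rw [wt_zero h0] at hw
    refine ⟨?_, hw.symm⟩
    funext μ i
    refine h.eq_zero μ i fun hi => ?_
    obtain rfl : μ = 0 := by omega
    omega
  · rintro ⟨rfl, rfl⟩
    refine ⟨fun _ _ _ => rfl, fun μ hμ i hi => ?_, fun μ hμ => ?_, ?_⟩
    · obtain rfl : μ = 0 := by omega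
      omega
    · obtain rfl : μ = 0 := by omega
      rw [wt_zero h0]
      exact le_rfl
    · rw [wt_zero h0]
      rfl

theorem sum_isBounded_zero {e : ℕ → ℕ} (h0 : e 0 = 0) (d : ℕ) {N M : ℕ}
    {S : Finset (ℕ → ℕ → ℕ)} (hS : ∀ lam, lam ∈ S ↔ IsBounded 0 e N M lam) :
    ∑ lam ∈ S, fterm d 0 e N M lam = if N = 0 then 1 else 0 := by
  split_ifs with h
  · obtain rfl : S = {0} := by
      ext lam
      rw [hS, isBounded_zero h0, mem_singleton]
      simp [h]
    simp [fterm, h0, qpow_zero]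
  · obtain rfl : S = ∅ := by
      ext lam
      rw [hS, isBounded_zero h0]
      simp [h]
    rfl

/-! ### The fermionic form of the bosonic polynomials -/

theorem cfVal_add_one {n : ℕ} {c c' : ℕ → ℕ} (h0 : c 0 = c' 0 + 1)
    (h1 : ∀ i, c (i + 1) = c' (i + 1)) : cfVal n c = cfVal n c' + 1 := by
  cases n with
  | zero =>
    rw [cfVal, cfVal, h0]
    push_cast
    rfl
  | succ n =>
    rw [cfVal, cfVal, h0, funext h1]
    push_cast
    ring

/-- The entries `(e_0, …, e_{n-1}, e_n + 2)`. -/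
def entries (n : ℕ) (e : ℕ → ℕ) (i : ℕ) : ℕ := e i + if i = n then 2 else 0

/-- The pairs `(p, p')` and `(r, s)` occurring in the tree of Burge transforms. -/
structure IsBurgePair (p p' r s : ℕ) (x : ℚ) : Prop where
  pos : 0 < p
  pos' : 0 < p'
  coprime : Nat.Coprime p p'
  det_eq : |(p : ℤ) * s - p' * r| = 1
  two_mul_le : 2 * r ≤ p
  two_mul_le' : 2 * s ≤ p'
  eq_div : x = (p' : ℚ) / p

theorem IsBurgePair.add {p p' r s : ℕ} {x : ℚ} (h : IsBurgePair p p' r s x) :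
    IsBurgePair p (p' + p) r (s + r) (x + 1) where
  pos := h.pos
  pos' := Nat.add_pos_left h.pos' p
  coprime := by simpa using h.coprime
  det_eq := by
    rw [← h.det_eq]
    congr 1
    push_cast
    ring
  two_mul_le := h.two_mul_le
  two_mul_le' := by
    have := h.two_mul_le
    have := h.two_mul_le'
    omega
  eq_div := by
    have : (p : ℚ) ≠ 0 := by exact_mod_cast h.pos.ne'
    rw [h.eq_div]
    push_cast
    field_simp

theorem IsBurgePair.swap {p p' r s : ℕ} {x : ℚ} (h : IsBurgePair p p' r s x) :
    IsBurgePair p' p s r (0 + 1 / x) where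
  pos := h.pos'
  pos' := h.pos
  coprime := h.coprime.symm
  det_eq := by rw [abs_sub_comm, h.det_eq]
  two_mul_le := h.two_mul_le'
  two_mul_le' := h.two_mul_le
  eq_div := by rw [h.eq_div, zero_add, one_div_div]

/-- Doubly finite boson-fermion identities. -/
theorem exists_sum_fterm (n : ℕ) : ∀ m (e : ℕ → ℕ), e 0 = m → ∃ p p' r s : ℕ,
    IsBurgePair p p' r s (cfVal n (entries n e)) ∧
      ∀ (N M : ℕ) (S : Finset (ℕ → ℕ → ℕ)), (∀ lam, lam ∈ S ↔ IsBounded n e N M lam) →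
        ∑ lam ∈ S, fterm 0 n e N M lam = xpoly p p' r s N M := by
  induction n with
  | zero => ?_
  | succ n ihn => ?_
  -- Raising `e 0` by one is the same Burge transform for every `n`. The two goals with `e 0 = 0`
  -- remain: the base `p'/p = 2`, and the exchange of bounds that shortens the continued fraction.
  all_goals
    intro m
    induction m with
    | zero => ?_
    | succ m ihm =>
      intro e he
      set e' := Function.update e 0 m with he'
      have h0 : e 0 = e' 0 + 1 := by simp [he', he]
      have h1 : ∀ μ, e (μ + 1) = e' (μ + 1) := fun μ => by simp [he']
      obtain ⟨p, p', r, s, hb, hX⟩ := ihm e' (by simp [he'])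
      refine ⟨p, p' + p, r, s + r, ?_, fun N M S hS => ?_⟩
      · rw [cfVal_add_one (c' := entries _ e')]
        · exact hb.add
        · rw [entries, entries, h0]
          ring
        · intro i
          rw [entries, entries, h1]
      · have hr := hb.two_mul_le
        have hs := hb.two_mul_le'
        rw [sum_isBounded_cons h0 h1 hS (c := fun k => gauss (2 * N + M - k) (M - k) *
          qpow ((k : ℚ) ^ 2)) (F := fun k => xpoly p p' r s (N - k) k)
          (g := fun k l => fterm 0 _ e' (N - k) k l)]
        · have := xpoly_burge (p := p) (p' := p') (r := r) (s := s) (by exact_mod_cast hb.pos)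
            (by exact_mod_cast hb.pos') (by omega) (by omega) (by omega) (by omega) N M
          push_cast
          rw [← this]
          exact sum_congr rfl fun k _ => by ring
        · intro k l
          rw [fterm_zero_eq (by omega), fterm_one_consPart h0 h1, mul_assoc]
          rfl
        · intro k hk _
          rw [gauss_eq_zero (by omega), zero_mul]
        · intro k hk T hT
          have := hX (N - k) k T hT
          rwa [Nat.cast_sub hk] at this
  · intro e he
    refine ⟨1, 2, 0, 1, ⟨by norm_num, by norm_num, by norm_num, by norm_num, by norm_num,
      by norm_num, by simp [cfVal, entries, he]⟩, fun N M S hS => ?_⟩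
    rw [sum_isBounded_zero he 0 hS]
    exact_mod_cast (xpoly_one_two N M).symm
  · intro e he
    obtain ⟨p, p', r, s, hb, hX⟩ := ihn _ (fun μ => e (μ + 1)) rfl
    refine ⟨p', p, s, r, ?_, fun N M S hS => ?_⟩
    · have : cfVal (n + 1) (entries (n + 1) e) =
          0 + 1 / cfVal n (entries n fun μ => e (μ + 1)) := by
        rw [cfVal]
        congr 1
        · simp [entries, he]
        · congr 2
          funext i
          simp [entries]
      rw [this]
      exact hb.swap
    · rw [xpoly_swap]
      exact sum_isBounded_consRow he hS (hX M N)

/-! ### The index conventions of the fermionic form -/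

/-- Positivity of `e μ` for `μ < n` is essential: for `e μ = 0`, `w` would read the unused entry
`lam μ 0`, whereas `bounds` reads the incoming bound. -/
theorem IsAdmissible.bounds_eq {n : ℕ} {e : ℕ → ℕ} (L : ℕ) (he : ∀ μ < n, 0 < e μ)
    (lam : ℕ → ℕ → ℕ) : ∀ μ ≤ n,
      (bounds e lam ((L / 2 : ℕ) : ℤ) ((L / 2 : ℕ) : ℤ) μ).1 = w e L lam μ := by
  intro μ hμ
  cases μ with
  | zero => rfl
  | succ μ =>
    have := he μ (by omega)
    rw [bounds, w, ext, if_neg (by omega)]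

theorem part_eq_ext {n : ℕ} {e : ℕ → ℕ} (L : ℕ) (he : ∀ μ < n, 0 < e μ)
    (lam : ℕ → ℕ → ℕ) {μ i : ℕ} (hμ : μ ≤ n) (h : μ ≠ 0 ∨ i ≠ 0) :
    part e L lam μ i =
      ext (bounds e lam ((L / 2 : ℕ) : ℤ) ((L / 2 : ℕ) : ℤ) μ).2 (lam μ) i := by
  match μ, i with
  | 0, 0 => omega
  | 0, i + 1 => rfl
  | μ + 1, i + 1 => rfl
  | μ + 1, 0 =>
    rw [ext_zero, bounds, IsAdmissible.bounds_eq L he lam μ (by omega)]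
    rfl

theorem isAdmissible_iff {n : ℕ} {e : ℕ → ℕ} {L : ℕ} (he : ∀ μ < n, 0 < e μ)
    {lam : ℕ → ℕ → ℕ} :
    IsAdmissible n e L lam ↔
      IsBounded n e ((L / 2 : ℕ) : ℤ) ((L / 2 : ℕ) : ℤ) lam := by
  have hb := IsAdmissible.bounds_eq L he lam
  have hp := fun (μ i : ℕ) => part_eq_ext (μ := μ) (i := i) L he lam
  constructor
  · intro h
    refine ⟨h.eq_zero, fun μ hμ i hi => ?_, fun μ hμ => ?_, ?_⟩
    · match μ, i with
      | 0, 0 =>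
        -- The choice `M = L/2` imposes nothing new, since every part is already at most `L/2`.
        change (lam 0 1 : ℤ) ≤ ((L / 2 : ℕ) : ℤ)
        exact_mod_cast h.le 0 1
      | μ + 1, 0 =>
        have := h.first_le (μ + 1) (by omega) hμ
        rwa [hp _ 0 hμ (by omega)] at this
      | μ, i + 1 =>
        rw [ext_succ]
        exact_mod_cast h.antitone μ hμ (i + 1) (by omega) hi
    · rw [hb μ hμ]
      exact_mod_cast h.wt_le μ hμ
    · rw [hb n le_rfl]
      exact_mod_cast h.wt_eq
  · intro h
    refine ⟨h.eq_zero, fun μ hμ i hi hi' => ?_, fun μ h0 hμ => ?_, fun μ hμ => ?_, ?_⟩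
    · obtain ⟨i, rfl⟩ := Nat.exists_eq_add_of_le' hi
      have := h.le_ext μ hμ (i + 1) hi'
      rw [ext_succ] at this
      exact_mod_cast this
    · rw [hp μ 0 hμ (by omega), hp μ 1 hμ (by omega), ext_succ, zero_add]
      by_cases hμe : 0 < e μ
      · exact h.le_ext μ hμ 0 hμe
      -- An empty partition, possible here only for `μ = n`: the claim is `0 ≤ λ⁽μ⁾_0`, which is the
      -- weight bound one level up.
      · rw [h.eq_zero μ 1 (by omega), ext_zero]
        obtain ⟨ν, rfl⟩ := Nat.exists_eq_add_of_le' h0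
        have := h.wt_le ν (by omega)
        rw [bounds, Nat.cast_zero]
        exact sub_nonneg.2 this
    · have := h.wt_le μ hμ
      rw [hb μ hμ] at this
      exact_mod_cast this
    · have := h.wt_eq
      rw [hb n le_rfl] at this
      exact_mod_cast this

theorem fterm_eq {n : ℕ} {e : ℕ → ℕ} (L : ℕ) (he : ∀ μ < n, 0 < e μ) (lam : ℕ → ℕ → ℕ) :
    qpow (∑ μ ∈ range (n + 1), ∑ i ∈ Icc 1 (e μ), (lam μ i : ℚ) ^ 2) *
      ∏ μ ∈ range (n + 1), ∏ i ∈ Icc (1 + if μ = 0 then 1 else 0) (e μ),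
        gauss (2 * ((w e L lam μ : ℤ) - ∑ j ∈ Icc 1 i, (lam μ j : ℤ))
          + part e L lam μ (i - 1) + part e L lam μ i)
          (part e L lam μ (i - 1) - part e L lam μ i) =
      fterm 1 n e ((L / 2 : ℕ) : ℤ) ((L / 2 : ℕ) : ℤ) lam := by
  have hg : ∀ μ ≤ n, ∀ i, μ ≠ 0 ∨ i ≠ 0 →
      gauss (2 * ((w e L lam μ : ℤ) - ∑ j ∈ Icc 1 (i + 1), (lam μ j : ℤ))
          + part e L lam μ (i + 1 - 1) + part e L lam μ (i + 1))
          (part e L lam μ (i + 1 - 1) - part e L lam μ (i + 1)) =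
        gfactor (bounds e lam ((L / 2 : ℕ) : ℤ) ((L / 2 : ℕ) : ℤ) μ).1
          (bounds e lam ((L / 2 : ℕ) : ℤ) ((L / 2 : ℕ) : ℤ) μ).2 (lam μ) i := by
    intro μ hμ i hi
    rw [add_tsub_cancel_right, part_eq_ext L he lam hμ hi, part_eq_ext L he lam hμ (by omega),
      gfactor, IsAdmissible.bounds_eq L he lam μ hμ, sum_Icc_one, ext_succ]
  rw [fterm, sum_range_succ', add_comm, qpow_add, prod_range_succ', mul_comm (∏ μ ∈ range n, _)]
  simp only [sum_Icc_one (fun i => ((lam _ i : ℕ) : ℚ) ^ 2), if_true, Nat.succ_ne_zero, if_false,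
    prod_Icc_one_add]
  congr 2
  · refine prod_congr rfl fun i hi => ?_
    rw [mem_Ico] at hi
    exact hg 0 (Nat.zero_le n) i (by omega)
  · refine prod_congr rfl fun μ hμ => ?_
    rw [mem_range] at hμ
    rw [Nat.Ico_zero_eq_range]
    exact prod_congr rfl fun i _ => hg (μ + 1) (by omega) i (by omega)

/-! ### Identification of `(p, p')` and of the least pair. -/

theorem one_le_cfVal (n : ℕ) : ∀ c : ℕ → ℕ, (∀ i ≤ n, 1 ≤ c i) → 1 ≤ cfVal n c := by
  induction n with
  | zero =>
    intro c hc
    rw [cfVal]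
    exact_mod_cast hc 0 le_rfl
  | succ n ih =>
    intro c hc
    have h1 : (1 : ℚ) ≤ c 0 := by exact_mod_cast hc 0 (by omega)
    have h2 := ih (fun i => c (i + 1)) fun i hi => hc (i + 1) (by omega)
    have h3 : 0 ≤ 1 / cfVal n fun i => c (i + 1) := by positivity
    rw [cfVal]
    linarith

/-- Two solutions with equal signs differ by a multiple of `(p', p)`, with opposite signs they add
up to one. As `s₀ ≤ s` and `r₀ ≤ r`, the box `2s ≤ p'`, `2r ≤ p` leaves no room for distinct pairs
in either case. -/
theorem IsBurgePair.eq_of_isLeast {p p' r s r₀ s₀ : ℕ} {x : ℚ} (h : IsBurgePair p p' r s x)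
    (hmin : IsLeast {x : ℕ × ℕ | |(p : ℤ) * x.1 - (p' : ℤ) * x.2| = 1} (s₀, r₀)) :
    s₀ = s ∧ r₀ = r := by
  have hle := hmin.2 (show (s, r) ∈ _ from h.det_eq)
  obtain ⟨hs, hr⟩ : s₀ ≤ s ∧ r₀ ≤ r := hle
  have h1 : |(p : ℤ) * s₀ - p' * r₀| = 1 := hmin.1
  have h2 := h.det_eq
  have hr2 := h.two_mul_le
  have hs2 := h.two_mul_le'
  have hp := h.pos
  have hp' := h.pos'
  have key : p * (s - s₀) = p' * (r - r₀) ∨ p * (s + s₀) = p' * (r + r₀) := by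
    zify [hs, hr]
    rcases (abs_eq zero_le_one).1 h1 with h1 | h1 <;>
      rcases (abs_eq zero_le_one).1 h2 with h2 | h2
    · left; linarith
    · right; linarith
    · right; linarith
    · left; linarith
  rcases key with key | key
  · have hd : p' ∣ s - s₀ := h.coprime.symm.dvd_of_dvd_mul_left ⟨_, key⟩
    have hs0 : s - s₀ = 0 := Nat.eq_zero_of_dvd_of_lt hd (by omega)
    rw [hs0, mul_zero, eq_comm, mul_eq_zero] at key
    omega
  · have hd : p' ∣ s + s₀ := h.coprime.symm.dvd_of_dvd_mul_left ⟨_, key⟩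
    have hd' : p ∣ r + r₀ := h.coprime.dvd_of_dvd_mul_left ⟨_, key.symm⟩
    rcases Nat.eq_zero_or_pos (s + s₀) with h0 | h0
    · rw [h0, mul_zero, eq_comm, mul_eq_zero] at key
      omega
    · have := Nat.le_of_dvd h0 hd
      have hr0 : r + r₀ ≠ 0 := by
        intro hr0
        rw [hr0, mul_zero, mul_eq_zero] at key
        omega
      have := Nat.le_of_dvd (Nat.pos_of_ne_zero hr0) hd'
      omega

theorem IsBurgePair.eq_of_eq_div {p p' r s q q' : ℕ} {x : ℚ} (h : IsBurgePair p p' r s x)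
    (hq : 0 < q) (hcop : Nat.Coprime q q') (hx : x = (q' : ℚ) / q) : q = p ∧ q' = p' := by
  have hp0 : (p : ℚ) ≠ 0 := by exact_mod_cast h.pos.ne'
  have hq0 : (q : ℚ) ≠ 0 := by exact_mod_cast hq.ne'
  have h1 := h.eq_div.symm.trans hx
  rw [div_eq_div_iff hp0 hq0] at h1
  have h2 : p' * q = q' * p := by exact_mod_cast h1
  have h3 : q = p := Nat.dvd_antisymm
    (hcop.dvd_of_dvd_mul_left ⟨p', by linarith⟩)
    (h.coprime.dvd_of_dvd_mul_left ⟨q', by linarith⟩)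
  subst h3
  exact ⟨rfl, (Nat.eq_of_mul_eq_mul_right hq h2).symm⟩

end PathGen

end

theorem mainTheorem2 (p p' : ℕ) (hp : 0 < p) (hpp' : p < p') (hcop : Nat.Coprime p p')
    (s₀ r₀ : ℕ)
    (hmin : IsLeast {x : ℕ × ℕ | |(p : ℤ) * x.1 - (p' : ℤ) * x.2| = 1} (s₀, r₀))
    (n : ℕ) (e : ℕ → ℕ)
    (hcf : PathGen.IsContinuedFraction n (fun i => e i + if i = n then 2 else 0)
      ((p' : ℚ) / (p : ℚ)))
    (L : ℕ) (hL : Even L) :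
    PathGen.chi p p' (s₀ : ℤ) (s₀ : ℤ) ((s₀ : ℤ) + 1) L =
      ∑ lam ∈ PathGen.admissible n e L,
        PathGen.qpow (∑ μ ∈ Finset.range (n + 1), ∑ i ∈ Finset.Icc 1 (e μ), (lam μ i : ℚ) ^ 2) *
          ∏ μ ∈ Finset.range (n + 1), ∏ i ∈ Finset.Icc (1 + if μ = 0 then 1 else 0) (e μ),
            PathGen.gauss
              (2 * ((PathGen.w e L lam μ : ℤ) - ∑ j ∈ Finset.Icc 1 i, (lam μ j : ℤ))
                + PathGen.part e L lam μ (i - 1) + PathGen.part e L lam μ i)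
              (PathGen.part e L lam μ (i - 1) - PathGen.part e L lam μ i) := by
  open PathGen Finset in
  have hpos : ∀ i, 0 < i → i < n → 0 < e i := fun i h0 hi => by
    have := hcf.one_le i h0 hi
    rw [if_neg hi.ne] at this
    omega
  -- This is where `p < p'` enters: a zero first entry followed by further ones would give `p'/p ≤
  -- 1`.
  have he0 : 0 < n → 0 < e 0 := by
    intro hn
    by_contra hcon
    obtain ⟨k, rfl⟩ := Nat.exists_eq_add_of_le' hn
    have hv := hcf.eq_val
    rw [cfVal, if_neg (by omega), show e 0 = 0 by omega] at hv
    have h1 := one_le_cfVal k (fun i => e (i + 1) + if i + 1 = k + 1 then 2 else 0) fun i hi => by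
      by_cases hik : i = k
      · simp [hik]
      · have := hpos (i + 1) (by omega) (by omega)
        omega
    have h2 : (1 : ℚ) < p' / p := by
      rw [one_lt_div (by exact_mod_cast hp)]
      exact_mod_cast hpp'
    have h3 : 1 / cfVal k (fun i => e (i + 1) + if i + 1 = k + 1 then 2 else 0) ≤ 1 := by
      rw [div_le_one (by linarith)]
      exact h1
    rw [hv, add_zero, Nat.cast_zero, zero_add] at h2
    exact absurd h2 (not_lt.2 h3)
  have he : ∀ μ < n, 0 < e μ := fun μ hμ => by
    rcases Nat.eq_zero_or_pos μ with rfl | h0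
    · exact he0 hμ
    · exact hpos μ h0 hμ
  obtain ⟨N, rfl⟩ : ∃ N, L = 2 * N := hL.exists_two_nsmul L |>.imp fun N h => by simpa using h
  have hN : 2 * N / 2 = N := by omega
  rw [sum_congr rfl fun lam _ => fterm_eq (2 * N) he lam]
  have hS : ∀ lam, lam ∈ admissible n e (2 * N) ↔ IsBounded n e N N lam := fun lam => by
    rw [admissible, Set.Finite.mem_toFinset, Set.mem_ofPred_eq, isAdmissible_iff he, hN]
  rw [hN]
  have key : ∃ r s : ℕ, IsBurgePair p p' r s ((p' : ℚ) / p) ∧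
      ∑ lam ∈ admissible n e (2 * N), fterm 1 n e N N lam = ypoly p p' r s N := by
    rcases Nat.eq_zero_or_pos (e 0) with h0 | h0
    -- Here there are no parts at all and `p'/p = 2`, so `ypoly 1 2 0 1` is evaluated directly.
    · obtain rfl : n = 0 := by
        by_contra hn
        have := he0 (Nat.pos_of_ne_zero hn)
        omega
      have hb : IsBurgePair 1 2 0 1 ((p' : ℚ) / p) :=
        ⟨by norm_num, by norm_num, by norm_num, by norm_num, by norm_num, by norm_num, by
          rw [hcf.eq_val]; simp [cfVal, h0]⟩
      obtain ⟨rfl, rfl⟩ := hb.eq_of_eq_div hp hcop rfl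
      refine ⟨0, 1, hb, ?_⟩
      rw [sum_isBounded_zero h0 1 hS]
      exact_mod_cast (ypoly_one_two N).symm
    -- One unit of `e 0` is held back: it is supplied by the limiting transform `sum_xpoly`, applied
    -- to the doubly bounded identity for `e'`.
    · set e' := Function.update e 0 (e 0 - 1) with he'
      have h0' : e 0 = e' 0 + 1 := by
        simp only [he', Function.update_self]
        omega
      have h1 : ∀ μ, e (μ + 1) = e' (μ + 1) := fun μ => by simp [he']
      obtain ⟨q, q', r, s, hb, hX⟩ := exists_sum_fterm n _ e' rfl
      have hb' : IsBurgePair q (q' + q) r (s + r) ((p' : ℚ) / p) := by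
        have : (p' : ℚ) / p = cfVal n (entries n e') + 1 := by
          rw [hcf.eq_val]
          refine cfVal_add_one ?_ fun i => ?_
          · rw [entries, h0']
            ring
          · rw [entries, h1]
        rw [this]
        exact hb.add
      obtain ⟨rfl, rfl⟩ := hb'.eq_of_eq_div hp hcop rfl
      refine ⟨r, s + r, hb', ?_⟩
      have hr := hb.two_mul_le
      have hs := hb.two_mul_le'
      rw [sum_isBounded_cons h0' h1 hS (c := fun k => qpow ((k : ℚ) ^ 2))
        (F := fun k => xpoly p q' r s (N - k) k) (g := fun k l => fterm 0 n e' (N - k) k l)]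
      · have := sum_xpoly (p := p) (p' := q') (r := r) (s := s) (by exact_mod_cast hb.pos)
          (by exact_mod_cast hb.pos') (by omega) (by omega) (by omega) (by omega) N
        push_cast
        exact this
      · exact fun k l => fterm_one_consPart h0' h1 n N N k l
      · intro k hk hk'
        omega
      · intro k hk T hT
        have := hX (N - k) k T hT
        rwa [Nat.cast_sub hk] at this
  obtain ⟨r, s, hb, hsum⟩ := key
  obtain ⟨rfl, rfl⟩ := hb.eq_of_isLeast hmin
  rw [hsum]
  have hs := hb.two_mul_le'
  -- If `s₀ = 0`, the determinant condition would make `p' ≥ 2` divide `1`.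
  have hs1 : 1 ≤ s₀ := by
    by_contra hcon
    obtain rfl : s₀ = 0 := by omega
    have hd : (p' : ℤ) ∣ 1 := by
      rcases (abs_eq zero_le_one).1 hb.det_eq with h | h
      · exact ⟨-r₀, by push_cast at h; linarith⟩
      · exact ⟨r₀, by push_cast at h; linarith⟩
    have := Int.le_of_dvd one_pos hd
    omega
  exact chi_eq_ypoly hp hpp' hs1 (by omega) hb.two_mul_le hb.det_eq N
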